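/- **Conventions.** An $n$-tree is a finite tree whose leaves (vertices of degree one) are numbered by $\{1,\dots,n\}$, with a length for each edge. An *equidistant* $5$-tree with root $r$ is a $5$-tree $T$ with positive rational edge lengths together with a vertex $r$, not a leaf, such that all leaves have the same distance to $r$; the height $h(e)$ of an edge $e$ is the distance from its top node (its endpoint nearer to $r$) to any leaf below $e$, and the length $D$ of $T$ is the sum of its edge lengths. $T$ is *binary* if every non-leaf vertex has exactly two children. For numbers or variables $a_j(e)$ ($j=1,2,3$, $e$ an edge of $T$) put $$x_i^{(j)}(t)=\sum_{e\text{ between }r\text{ and }i}a_j(e)\,t^{h(e)}\quad(1\le i\le 5),\qquad M=\begin{bmatrix}1&\cdots&1\\ x_1^{(1)}&\cdots&x_5^{(1)}\\ (x_1^{(1)})^2&\cdots&(x_5^{(1)})^2\\ x_1^{(2)}&\cdots&x_5^{(2)}\\ x_1^{(3)}&\cdots&x_5^{(3)}\end{bmatrix}.$$ Let $K=\mathbb C\{\{t\}\}$ be the field of Puiseux series with valuation $\mathrm{val}$. For $2\le m\le n$ let $I_{m,n}\subset K[x_{i_1\dots i_m}\mid i_1<\dots<i_m]$ be the ideal of all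 relations between the maximal minors of an $m\times n$ matrix, and let the tropical Grassmannian $\mathcal G_{m,n}\subset\mathbb R^{\binom nm}$ be its tropical variety, i.e. the closure of the set of points $(-\mathrm{val}(x_I))_I$, where $x$ runs over the zeros of $I_{m,n}$ with all coordinates nonzero. Let $\mathcal T_n\subset\mathbb R^{\binom n2}$ be the set of vectors $(D(i,j))_{i<j}$ of leaf distances in weighted $n$-trees (nonnegative lengths on the internal edges, arbitrary real lengths on the edges ending in a leaf). Let $\phi^{(m)}:\mathbb R^{\binom n2}\to\mathbb R^{\binom nm}$ be given by $$\phi^{(m)}(X)_{i_1,\dots,i_m}=\tfrac12\min_{\sigma}\{X_{i_1,i_{\sigma(1)}}+X_{i_{\sigma(1)},i_{\sigma^2(1)}}+\dots+X_{i_{\sigma^{m-1}(1)},i_{\sigma^m(1)}}\},$$ where $X_{i,j}=X_{j,i}$ and $\sigma$ runs over the cyclic permutations of length $m$ in $\mathcal S_m$. **Theorem.** (1) Let $T$ be an equidistant $5$-tree with root $r$. With the $a_j(e)$ as variables, $\det M$ has degree exactly $D$ in $t$, and its leading coefficient $c_T$ is a nonzero homogeneous polynomial of degree $5$ in the $a_j(e)$.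 For all complex numbers $a_j(e)$ at which $c_T$ does not vanish, $\det M$ has degree $D$ in $t$. (2) If $T$ is binary, its combinatorial type (as a rooted tree, with leaf numbers forgotten) is one of the three types $(((\bullet,\bullet),\bullet),(\bullet,\bullet))$, $((((\bullet,\bullet),\bullet),\bullet),\bullet)$ and $(((\bullet,\bullet),(\bullet,\bullet)),\bullet)$. The polynomial $c_T$ has exactly $272$ terms for the first type and exactly $144$ terms for each of the other two. (3) For every $n\ge 5$, $$\phi^{(5)}(\mathcal T_n)\subset\mathcal G_{5,n}\cap\phi^{(5)}(\mathbb R^{\binom n2})\qquad\text{and}\qquad \phi^{(5)}(\mathcal G_{2,n})\subset\mathcal G_{5,n}\cap\phi^{(5)}(\mathbb R^{\binom n2}).$$ -/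

import Mathlib

noncomputable section

/-! ### Puiseux series -/

/-- The field `ℂ{{t}}` of Puiseux series in `t`: formal series `∑ c_q t^q` with rational exponents
whose support is bounded below and has a common denominator.  A subset of `(1/N)ℤ` is well-ordered
if and only if it is bounded below, so these are the Hahn series over `ℚ` whose support has a
common denominator. -/
def puiseuxField : Subfield (HahnSeries ℚ ℂ) where
  carrier := {c | ∃ N : ℕ, 0 < N ∧ ∀ q ∈ c.support, ∃ k : ℤ, q = (k : ℚ) / N}
  zero_mem' := ⟨1, one_pos, by simp⟩
  one_mem' := ⟨1, one_pos, by
    intro q hq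
    rw [HahnSeries.support_one] at hq
    exact ⟨0, by simpa using hq⟩⟩
  neg_mem' := by
    rintro c ⟨N, hN, h⟩
    exact ⟨N, hN, fun q hq => h q (by simpa using hq)⟩
  add_mem' := by
    rintro c d ⟨N, hN, h⟩ ⟨N', hN', h'⟩
    have hn : (N : ℚ) ≠ 0 := by positivity
    have hn' : (N' : ℚ) ≠ 0 := by positivity
    refine ⟨N * N', Nat.mul_pos hN hN', fun q hq => ?_⟩
    rcases HahnSeries.support_add_subset (x := c) (y := d) hq with hq | hq
    · obtain ⟨k, rfl⟩ := h q hq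
      exact ⟨k * N', by push_cast; field_simp⟩
    · obtain ⟨k, rfl⟩ := h' q hq
      exact ⟨k * N, by push_cast; field_simp⟩
  mul_mem' := by
    rintro c d ⟨N, hN, h⟩ ⟨N', hN', h'⟩
    have hn : (N : ℚ) ≠ 0 := by positivity
    have hn' : (N' : ℚ) ≠ 0 := by positivity
    refine ⟨N * N', Nat.mul_pos hN hN', fun q hq => ?_⟩
    obtain ⟨a, ha, b, hb, rfl⟩ := HahnSeries.support_mul_subset hq
    obtain ⟨k, rfl⟩ := h a ha
    obtain ⟨l, rfl⟩ := h' b hb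
    exact ⟨k * N' + l * N, by push_cast; field_simp⟩
  inv_mem' := by
    rintro c ⟨N, hN, h⟩
    have hn : (0 : ℚ) < N := by positivity
    let g : ℤ →+ ℚ :=
      { toFun := fun k => (k : ℚ) / N
        map_zero' := by simp
        map_add' := fun a b => by push_cast; ring }
    have hg : StrictMono g := fun a b hab => by
      change (a : ℚ) / N < (b : ℚ) / N
      have : (a : ℚ) < b := by exact_mod_cast hab
      gcongr
    let F : HahnSeries ℤ ℂ →+* HahnSeries ℚ ℂ :=
      HahnSeries.embDomainRingHom g hg.injective (fun _ _ => hg.le_iff_le)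
    let y : HahnSeries ℤ ℂ :=
      { coeff := fun k => c.coeff (g k)
        isPWO_support' := by
          have h1 : (Function.support fun k => c.coeff (g k)) = g ⁻¹' c.support := rfl
          rw [h1, Set.isPWO_iff_isWF, Set.isWF_iff_no_descending_seq]
          intro u hu hmem
          exact Set.isWF_iff_no_descending_seq.1 c.isWF_support (g ∘ u)
            (hg.comp_strictAnti hu) hmem }
    have hy : c = F y := by
      ext q
      by_cases hq : q ∈ Set.range g
      · obtain ⟨k, rfl⟩ := hq
        exact (HahnSeries.embDomain_coeff (f := ⟨⟨g, hg.injective⟩, hg.le_iff_le⟩) (x := y) (a := k)).symm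
      · rw [show (F y).coeff q = 0 from
          HahnSeries.embDomain_of_notMem_range (f := ⟨⟨g, hg.injective⟩, hg.le_iff_le⟩) hq]
        by_contra h0
        obtain ⟨k, hk⟩ := h q h0
        exact hq ⟨k, hk.symm⟩
    refine ⟨N, hN, fun q hq => ?_⟩
    rw [hy, ← map_inv₀] at hq
    obtain ⟨k, -, hk⟩ :=
      HahnSeries.support_embDomain_subset (f := ⟨⟨g, hg.injective⟩, hg.le_iff_le⟩) hq
    exact ⟨k, hk.symm⟩

/-- The valuation of a nonzero Puiseux series: the minimum of its support. -/
def puiseuxVal (c : puiseuxField) : ℚ := (c : HahnSeries ℚ ℂ).order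

/-! ### Tropical varieties and tropical Grassmannians -/

/-- The tropical variety of an ideal `I` of a polynomial ring over the Puiseux series: the closure
in real space of the set of all `(-val x_s)_s`, where `x` runs over the points of `V(I)` with
nonzero coordinates. -/
def tropicalVariety {σ : Type*} (I : Ideal (MvPolynomial σ puiseuxField)) : Set (σ → ℝ) :=
  closure {y | ∃ x : σ → puiseuxField,
    (∀ s, x s ≠ 0) ∧ (∀ f ∈ I, MvPolynomial.eval x f = 0) ∧
      ∀ s, y s = ((-puiseuxVal (x s) : ℚ) : ℝ)}

/-- The ideal `I_{m,n}` of all relations between the `m × m` minors of an `m × n` matrix.  The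
variables `x_{i_1 … i_m}` with `i_1 < … < i_m` are indexed by the increasing maps `Fin m ↪o Fin n`,
and `I_{m,n}` is the kernel of the map that sends each variable to the corresponding minor of the
generic matrix. -/
def grassmannIdeal (m n : ℕ) : Ideal (MvPolynomial (Fin m ↪o Fin n) puiseuxField) :=
  RingHom.ker (MvPolynomial.aeval (R := puiseuxField) fun s : Fin m ↪o Fin n =>
    ((Matrix.mvPolynomialX (Fin m) (Fin n) puiseuxField).submatrix id s).det)

/-- The tropical Grassmannian `𝒢_{m,n}`. -/
def tropicalGrassmannian (m n : ℕ) : Set ((Fin m ↪o Fin n) → ℝ) :=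
  tropicalVariety (grassmannIdeal m n)

/-! ### The map `φ^(m)` -/

/-- The increasing pair `i < j`. -/
def increasingPair {n : ℕ} (i j : Fin n) (h : i < j) : Fin 2 ↪o Fin n :=
  OrderEmbedding.ofStrictMono ![i, j] (by
    intro a b hab
    fin_cases a <;> fin_cases b <;> simp_all)

/-- The entry `X_{i,j} = X_{j,i}` of a vector indexed by the pairs `i < j` (and `0` if `i = j`). -/
def pairEntry {n : ℕ} (X : (Fin 2 ↪o Fin n) → ℝ) (i j : Fin n) : ℝ :=
  if h : i < j then X (increasingPair i j h)
  else if h : j < i then X (increasingPair j i h)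
  else 0

/-- The map `φ^(m)`, for `m ≥ 2`.  The minimum is over the cyclic permutations `σ` of length `m`;
as `σ` has a single orbit, the sum of `X_{i_a, i_{σ(a)}}` over all `a` is
`X_{i_1,i_{σ(1)}} + X_{i_{σ(1)},i_{σ²(1)}} + … + X_{i_{σ^{m-1}(1)},i_{σ^m(1)}}`. -/
def phi (m n : ℕ) (X : (Fin 2 ↪o Fin n) → ℝ) : (Fin m ↪o Fin n) → ℝ := fun s =>
  1 / 2 * ⨅ σ : {σ : Equiv.Perm (Fin m) // σ.IsCycle ∧ σ.support = Finset.univ},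
    ∑ a, pairEntry X (s a) (s (σ.1 a))

/-! ### Weighted trees -/

/-- A weighted `n`-tree with vertices `V` and edge lengths in `R`: a tree whose leaves (vertices of
degree one) are numbered by `Fin n`, with a length for each edge. -/
structure WeightedTree (V : Type*) (R : Type*) (n : ℕ) where
  graph : SimpleGraph V
  isTree : graph.IsTree
  leaf : Fin n → V
  leaf_injective : Function.Injective leaf
  range_leaf : Set.range leaf = {v | (graph.neighborSet v).ncard = 1}
  length : graph.edgeSet → R

namespace WeightedTree

variable {V : Type*} {R : Type*} {n : ℕ}

/-- The edges of the tree. -/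
abbrev Edge (T : WeightedTree V R n) : Type _ := T.graph.edgeSet

/-- The edge underlying an oriented edge. -/
def edge (T : WeightedTree V R n) (d : T.graph.Dart) : T.Edge := ⟨d.edge, d.edge_mem⟩

/-- The unique path from `u` to `v`. -/
def path (T : WeightedTree V R n) (u v : V) : T.graph.Walk u v :=
  (T.isTree.existsUnique_path u v).choose

/-- The distance between `u` and `v`: the sum of the lengths of the edges of the path. -/
def dist [AddCommMonoid R] (T : WeightedTree V R n) (u v : V) : R :=
  ((T.path u v).darts.map fun d => T.length (T.edge d)).sum

/-- The length of the tree: the sum of the lengths of all edges. -/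
def totalLength [AddCommMonoid R] (T : WeightedTree V R n) : R := ∑ᶠ e : T.Edge, T.length e

/-- The dissimilarity vector `(D(i,j))_{i<j}`. -/
def dissimilarityVector (T : WeightedTree V ℝ n) : (Fin 2 ↪o Fin n) → ℝ :=
  fun s => T.dist (T.leaf (s 0)) (T.leaf (s 1))

/-- The tree is equidistant with root `r`: the edge lengths are positive, `r` is a vertex that is
not a leaf, and all leaves have the same distance to `r`. -/
def IsEquidistant (T : WeightedTree V ℚ n) (r : V) : Prop :=
  (∀ e, 0 < T.length e) ∧ r ∉ Set.range T.leaf ∧ ∃ d : ℚ, ∀ i, T.dist r (T.leaf i) = d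

/-- The tree with root `r` is binary: every vertex that is not a leaf has exactly two children. -/
def IsBinary (T : WeightedTree V R n) (r : V) : Prop :=
  (T.graph.neighborSet r).ncard = 2 ∧
    ∀ v, v ≠ r → v ∉ Set.range T.leaf → (T.graph.neighborSet v).ncard = 3

/-- The tree with root `r` has the combinatorial type of the graph `G` with root `r'`: there is an
isomorphism of graphs that respects the roots. -/
def HasType {W : Type*} (T : WeightedTree V R n) (r : V) (G : SimpleGraph W) (r' : W) : Prop :=
  ∃ f : T.graph ≃g G, f r = r'

/-- The element `x_i(t) = ∑_e a(e) t^{h(e)}`, where `e` runs over the edges between the root `r` and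
the leaf `i`.  It is a finite sum of monomials `c t^q` with `q` rational, i.e. an element of the
monoid algebra of `ℚ` over the coefficient ring `A`.  Each edge `e` on the path from `r` to the leaf
is oriented away from `r`, so `d.fst` is its top node, and its height `h(e)` is the distance from
`d.fst` to the leaf `i` (for an equidistant tree: to any leaf below `e`). -/
def leafSeries {A : Type*} [CommRing A] (T : WeightedTree V ℚ n) (r : V) (a : T.Edge → A)
    (i : Fin n) : AddMonoidAlgebra A ℚ :=
  ((T.path r (T.leaf i)).darts.map fun d =>
    AddMonoidAlgebra.single (T.dist d.fst (T.leaf i)) (a (T.edge d))).sum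

/-- The matrix `M` for `m = 5`, with rows `1`, `x^(1)`, `(x^(1))²`, `x^(2)`, `x^(3)`. -/
def matrixM {A : Type*} [CommRing A] (T : WeightedTree V ℚ 5) (r : V)
    (a : Fin 3 → T.Edge → A) : Matrix (Fin 5) (Fin 5) (AddMonoidAlgebra A ℚ) :=
  Matrix.of ![fun _ => 1,
    fun i => T.leafSeries r (a 0) i,
    fun i => T.leafSeries r (a 0) i ^ 2,
    fun i => T.leafSeries r (a 1) i,
    fun i => T.leafSeries r (a 2) i]

/-- The determinant of `M` with the numbers `a_j(e)` left as variables. -/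
def genericDet (T : WeightedTree V ℚ 5) (r : V) :
    AddMonoidAlgebra (MvPolynomial (Fin 3 × T.Edge) ℂ) ℚ :=
  (T.matrixM r fun j e => MvPolynomial.X (j, e)).det

/-- The coefficient `c_T` of `t^D` in the generic determinant, where `D` is the length of `T`. -/
def leadingPolynomial (T : WeightedTree V ℚ 5) (r : V) : MvPolynomial (Fin 3 × T.Edge) ℂ :=
  (T.genericDet r).coeff T.totalLength

end WeightedTree

/-- `f` is nonzero of degree `q` in `t`. -/
def HasTDegree {A : Type*} [CommRing A] (f : AddMonoidAlgebra A ℚ) (q : ℚ) : Prop :=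
  IsGreatest {p | f.coeff p ≠ 0} q

/-- The set `𝒯_n` of dissimilarity vectors of weighted `n`-trees: finite trees whose internal edges
have nonnegative length; the edges that end in a leaf may have any real length. -/
def treeSpace (n : ℕ) : Set ((Fin 2 ↪o Fin n) → ℝ) :=
  {X | ∃ (V : Type) (_ : Finite V) (T : WeightedTree V ℝ n),
    (∀ e : T.Edge, (∀ i, T.leaf i ∉ (e : Sym2 V)) → 0 ≤ T.length e) ∧
      X = T.dissimilarityVector}

/-! ### The three combinatorial types of binary rooted trees with five leaves

In each graph the root is `0` and the leaves are `4, …, 8`. -/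

/-- The type `(((•,•),•),(•,•))`: with `r = 0`, `v = 1`, `u = 2`, `w = 3`, the node `r` has the
children `v` and `u`, the node `v` has as children `w` and a leaf, and `u` and `w` have two leaves
as children. -/
def typeThreeTwo : SimpleGraph (Fin 9) := SimpleGraph.fromEdgeSet
  {s(0, 1), s(0, 2), s(1, 3), s(3, 4), s(3, 5), s(1, 6), s(2, 7), s(2, 8)}

/-- The type `((((•,•),•),•),•)`. -/
def typeCaterpillar : SimpleGraph (Fin 9) := SimpleGraph.fromEdgeSet
  {s(0, 1), s(1, 2), s(2, 3), s(3, 4), s(3, 5), s(2, 6), s(1, 7), s(0, 8)}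

/-- The type `(((•,•),(•,•)),•)`. -/
def typeBalanced : SimpleGraph (Fin 9) := SimpleGraph.fromEdgeSet
  {s(0, 1), s(1, 2), s(1, 3), s(2, 4), s(2, 5), s(3, 6), s(3, 7), s(0, 8)}

end

/-!
Seen from its leaves, an equidistant tree is a *leaf system* (`LeafSystem`): the edges above a leaf
are ordered by their heights, and two leaves share the edges above their separation, which is the
height of their lowest common vertex.  Separations form an ultrametric, and every finite ultrametric
arises in this way (`IsUltrametric.leafSystem`), so both parts of the theorem are about leaf systems.

**The determinant.**  Subtract from each column but the first an earlier column.  The series of two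
leaves agree above their separation, so the differences `x_i - x_k` lead at the separation of `i` and
`k`.  In the row of squares a factor `x_i + x_k` remains, and after subtracting a multiple of the row
of `x` it leads at the height `H` of the root.  By the Leibniz formula the determinant leads at `H`
plus the sum of the chosen separations (`LeafSystem.leadsAt_det`).  If each leaf is compared with the
first of the nearest earlier leaves, the coefficient found there is nonzero
(`LeafSystem.leadCoeff_ne_zero`): each difference then has a leading edge that leads in none of the
others, so the differences can be prescribed.  The exponent is the length of the tree, because the
paths to the leaves, added one by one, contribute new parts whose lengths are these separations
(`WeightedTree.totalLength_eq`).

**The number of terms.**  Leaf counts show that a binary tree has one of the three types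
(`WeightedTree.hasType_of_isBinary`).  For each of them `c_T` is, up to sign and the names of the
variables, one explicit polynomial (`WeightedTree.card_support_of_hasType`), whose terms are
collected and counted by a computation on lists.

**The tropical Grassmannian.**  In a planar order of the leaves each leaf is compared with its
predecessor, and the degree of the determinant becomes the length of a closed tour through the five
leaves; every other tour is at least as long (`LeafSystem.exists_leadsAt_det_tour`).  So for generic
coefficients the matrix with columns `(1, x, x², y, z)`, multiplied by powers of `t`, has minors of
the degrees `φ⁽⁵⁾(X)` if `X` is a rational ultrametric plus weights of the leaves
(`phi_mem_tropicalGrassmannian_of_rat`).  A vector that satisfies the four-point condition is a real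
ultrametric plus weights of the leaves; rounding down preserves ultrametrics, and the tropical
Grassmannian is closed, so `φ⁽⁵⁾` maps it into `𝒢_{5,n}` as well (`FourPoint.phi_mem`).  Finally,
dissimilarity vectors of trees satisfy the four-point condition (`treeSpace_subset`), and so do the
points of `𝒢_{2,n}`, by the three-term Plücker relations (`tropicalGrassmannian_two_subset`).
-/

noncomputable section

/-! ### Leading terms in `A[t^ℚ]` -/

/-- `f` is `c t^q` plus terms of degree less than `q`.  The coefficient `c` may vanish. -/
def LeadsAt {A : Type*} [CommRing A] (f : AddMonoidAlgebra A ℚ) (q : ℚ) (c : A) : Prop :=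
  f.coeff q = c ∧ ∀ p, q < p → f.coeff p = 0

namespace LeadsAt

variable {A : Type*} [CommRing A] {f g : AddMonoidAlgebra A ℚ} {q r : ℚ} {c d : A}

theorem single (q : ℚ) (c : A) : LeadsAt (AddMonoidAlgebra.single q c) q c :=
  ⟨by simp, fun p hp => by simp [hp.ne]⟩

theorem one : LeadsAt (1 : AddMonoidAlgebra A ℚ) 0 1 := single 0 1

theorem add (hf : LeadsAt f q c) (hg : LeadsAt g q d) : LeadsAt (f + g) q (c + d) :=
  ⟨by simp [hf.1, hg.1], fun p hp => by simp [hf.2 p hp, hg.2 p hp]⟩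

theorem neg (hf : LeadsAt f q c) : LeadsAt (-f) q (-c) :=
  ⟨by simp [hf.1], fun p hp => by simp [hf.2 p hp]⟩

theorem units_smul (hf : LeadsAt f q c) (k : ℤˣ) : LeadsAt (k • f) q (k • c) := by
  rcases Int.units_eq_one_or k with rfl | rfl
  · simpa using hf
  · simpa using hf.neg

theorem zero (q : ℚ) : LeadsAt (0 : AddMonoidAlgebra A ℚ) q 0 := ⟨by simp, by simp⟩

theorem sum {ι : Type*} (s : Finset ι) {f : ι → AddMonoidAlgebra A ℚ} {c : ι → A}
    (h : ∀ i ∈ s, LeadsAt (f i) q (c i)) : LeadsAt (∑ i ∈ s, f i) q (∑ i ∈ s, c i) := by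
  classical
  induction s using Finset.induction_on with
  | empty => simpa using zero q
  | insert a s ha ih =>
    rw [Finset.sum_insert ha, Finset.sum_insert ha]
    exact (h a (by simp)).add (ih fun i hi => h i (by simp [hi]))

theorem mul (hf : LeadsAt f q c) (hg : LeadsAt g r d) : LeadsAt (f * g) (q + r) (c * d) := by
  have key : ∀ {k : AddMonoidAlgebra A ℚ} {s : ℚ} {e : A}, LeadsAt k s e →
      ∀ a ∈ k.coeff.support, a ≤ s := by
    intro k s e hk a ha
    by_contra h
    exact (Finsupp.mem_support_iff.1 ha) (hk.2 a (not_le.1 h))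
  constructor
  · rw [← hf.1, ← hg.1, AddMonoidAlgebra.coeff_mul, Finsupp.sum, Finset.sum_eq_single q,
      Finsupp.sum, Finset.sum_eq_single r, if_pos rfl]
    · intro b _ hb
      exact if_neg fun h => hb (add_left_cancel h)
    · intro h
      rw [if_pos rfl, Finsupp.notMem_support_iff.1 h, mul_zero]
    · intro a ha hne
      refine Finset.sum_eq_zero fun b hb => if_neg fun h => hne ?_
      have := key hf a ha
      have := key hg b hb
      linarith
    · intro h
      refine Finset.sum_eq_zero fun b _ => ?_
      simp [Finsupp.notMem_support_iff.1 h]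
  · intro p hp
    by_contra h
    obtain ⟨a, ha, b, hb, hab⟩ := Finset.mem_add.1
      (AddMonoidAlgebra.support_coeff_mul_subset f g (Finsupp.mem_support_iff.2 h))
    have := key hf a ha
    have := key hg b hb
    subst hab
    linarith

theorem prod {ι : Type*} (s : Finset ι) {f : ι → AddMonoidAlgebra A ℚ} {q : ι → ℚ} {c : ι → A}
    (h : ∀ i ∈ s, LeadsAt (f i) (q i) (c i)) :
    LeadsAt (∏ i ∈ s, f i) (∑ i ∈ s, q i) (∏ i ∈ s, c i) := by
  classical
  induction s using Finset.induction_on with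
  | empty => simpa using one
  | insert a s ha ih =>
    rw [Finset.prod_insert ha, Finset.prod_insert ha, Finset.sum_insert ha]
    exact (h a (by simp)).mul (ih fun i hi => h i (by simp [hi]))

/-- If the entry `(i, j)` of a square matrix leads at `u i + v j`, then every term of the Leibniz
formula leads at `∑ u + ∑ v`, hence so does the determinant. -/
theorem det {ι : Type*} [Fintype ι] [DecidableEq ι] {N : Matrix ι ι (AddMonoidAlgebra A ℚ)}
    {B : Matrix ι ι A} {u v : ι → ℚ} (h : ∀ i j, LeadsAt (N i j) (u i + v j) (B i j)) :
    LeadsAt N.det (∑ i, u i + ∑ i, v i) B.det := by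
  rw [Matrix.det_apply, Matrix.det_apply]
  refine sum _ fun σ _ => ?_
  have h1 : LeadsAt (∏ i, N (σ i) i) (∑ i, u i + ∑ i, v i) (∏ i, B (σ i) i) := by
    have := prod Finset.univ fun i _ => h (σ i) i
    rwa [Finset.sum_add_distrib, Equiv.sum_comp σ u] at this
  exact h1.units_smul _

theorem hasTDegree (hf : LeadsAt f q c) (hc : c ≠ 0) : HasTDegree f q :=
  ⟨by simpa [hf.1] using hc, fun p hp => by
    by_contra h
    exact hp (hf.2 p (not_le.1 h))⟩

/-- The coefficients of `f` above `q` vanish, so the leading exponent of `f` is at most `q`. -/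
theorem le_of_ne_zero (hf : LeadsAt f q c) (hc : c ≠ 0) (hf' : LeadsAt f r d) : q ≤ r := by
  by_contra h
  exact hc (hf.1 ▸ hf'.2 q (not_le.1 h))

/-- The leading coefficient is unique. -/
theorem eq_of_ne_zero (hf : LeadsAt f q c) (hf' : LeadsAt f r d) (hc : c ≠ 0) (hd : d ≠ 0) :
    c = d := by
  obtain rfl := le_antisymm (hf.le_of_ne_zero hc hf') (hf'.le_of_ne_zero hd hf)
  exact hf.1.symm.trans hf'.1

end LeadsAt

/-! ### The determinant with rows `1, x, x², y, z` -/

/-- The matrix with rows `1, x, x², y, z`. -/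
def quadMatrix {R κ : Type*} [CommRing R] (x : Fin 3 → κ → R) : Matrix (Fin 5) κ R :=
  Matrix.of ![fun _ => 1, x 0, fun i => x 0 i ^ 2, x 1, x 2]

theorem quadMatrix_comp {R κ κ' : Type*} [CommRing R] (x : Fin 3 → κ → R) (f : κ' → κ) :
    quadMatrix (fun j i => x j (f i)) = (quadMatrix x).submatrix id f := by
  ext k i
  fin_cases k <;> simp [quadMatrix]

/-- The `4 × 4` matrix with rows `b₀, b₀ s, b₁, b₂`. -/
def diffMatrix {R : Type*} [CommRing R] (b : Fin 3 → Fin 4 → R) (s : Fin 4 → R) :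
    Matrix (Fin 4) (Fin 4) R :=
  Matrix.of ![b 0, fun i => b 0 i * s i, b 1, b 2]

/-- Subtracting from each column but the first an earlier column `p i`, and then a multiple of the
row of `x` from the row of `x²`, reduces the determinant to one of differences.  The multiple `2 w`
is free: it serves to cancel a common part `w` of the `x i`. -/
theorem det_quadMatrix {R : Type*} [CommRing R] (x : Fin 3 → Fin 5 → R) (w : R)
    (p : Fin 4 → Fin 5) (hp : ∀ i, p i < i.succ) :
    (quadMatrix x).det = (diffMatrix (fun j i => x j i.succ - x j (p i))
      (fun i => x 0 i.succ + x 0 (p i) - 2 * w)).det := by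
  classical
  set M := quadMatrix x
  let E : Matrix (Fin 5) (Fin 5) R := Matrix.of fun k j =>
    Fin.cases (if k = 0 then 1 else 0)
      (fun i => (if k = i.succ then 1 else 0) - (if k = p i then 1 else 0)) j
  have hE : E.det = 1 := by
    rw [Matrix.det_of_isUpperTriangular]
    · refine Finset.prod_eq_one fun i _ => ?_
      refine Fin.cases ?_ (fun j => ?_) i
      · simp [E]
      · simp [E, (hp j).ne']
    · intro k j hkj
      simp only [id] at hkj
      revert hkj
      refine Fin.cases ?_ (fun i => ?_) j
      · intro h; simp [E, (show k ≠ 0 from h.ne')]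
      · intro h
        simp [E, h.ne', ((hp i).trans h).ne']
  have hME : ∀ k i, (M * E) k (Fin.succ i) = M k i.succ - M k (p i) := by
    intro k i
    simp [Matrix.mul_apply, E, mul_sub, Finset.sum_sub_distrib]
  have hME0 : ∀ k, (M * E) k 0 = M k 0 := by
    intro k
    simp [Matrix.mul_apply, E]
  have h1 : M.det = ((M * E).submatrix Fin.succ Fin.succ).det := by
    rw [show M.det = (M * E).det by rw [Matrix.det_mul, hE, mul_one], Matrix.det_succ_row_zero,
      Fin.sum_univ_succ, Finset.sum_eq_zero]
    · rw [hME0]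
      simp [M, quadMatrix, Fin.succAbove_zero]
    · intro i _
      rw [hME]
      simp [M, quadMatrix]
  set N := (M * E).submatrix Fin.succ Fin.succ
  have hN : ∀ k i, N k i = M k.succ i.succ - M k.succ (p i) := fun k i => hME _ _
  rw [h1, ← Matrix.det_updateRow_add_smul_self N (i := 1) (j := 0) (by decide) (-(2 * w))]
  congr 1
  ext k i
  fin_cases k
  · simp [hN, M, quadMatrix, diffMatrix]
  · simp [hN, M, quadMatrix, diffMatrix]
    ring
  · simp [hN, M, quadMatrix, diffMatrix]
  · simp [hN, M, quadMatrix, diffMatrix]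

/-- In the matrix of differences, the leading exponents are a row term (`H` in the row `x²`, else `0`)
plus a column term `u i`. -/
theorem LeadsAt.det_quadMatrix {A : Type*} [CommRing A] {x : Fin 3 → Fin 5 → AddMonoidAlgebra A ℚ}
    {w : AddMonoidAlgebra A ℚ} {p : Fin 4 → Fin 5} (hp : ∀ i, p i < i.succ) {u : Fin 4 → ℚ} {H : ℚ}
    {b : Fin 3 → Fin 4 → A} {s : Fin 4 → A}
    (hb : ∀ j i, LeadsAt (x j i.succ - x j (p i)) (u i) (b j i))
    (hs : ∀ i, LeadsAt (x 0 i.succ + x 0 (p i) - 2 * w) H (s i)) :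
    LeadsAt (quadMatrix x).det (H + ∑ i, u i) (diffMatrix b s).det := by
  rw [_root_.det_quadMatrix x w p hp]
  have h : ∀ k i, LeadsAt (diffMatrix (fun j i => x j i.succ - x j (p i))
      (fun i => x 0 i.succ + x 0 (p i) - 2 * w) k i) (![0, H, 0, 0] k + u i)
      (diffMatrix b s k i) := by
    intro k i
    fin_cases k
    · simpa [diffMatrix] using hb 0 i
    · simpa [diffMatrix, add_comm] using (hb 0 i).mul (hs i)
    · simpa [diffMatrix] using hb 1 i
    · simpa [diffMatrix] using hb 2 i
  simpa [Fin.sum_univ_four] using LeadsAt.det h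

/-! ### Leaf systems -/

/-- The combinatorial data of an equidistant tree, seen from its leaves: each leaf `i` has a finite
set `path i` of edges, ordered by a height, and any two leaves `i ≠ k` share exactly those edges
that lie above the height `sep i k`, where both paths have an edge. -/
structure LeafSystem (ι E : Type*) where
  path : ι → Finset E
  height : E → ℚ
  sep : ι → ι → ℚ
  height_injOn : ∀ i, Set.InjOn height (path i)
  sep_comm : ∀ i k, sep i k = sep k i
  mem_iff : ∀ {i k}, i ≠ k → ∀ e ∈ path i, (e ∈ path k ↔ sep i k < height e)
  exists_height_eq : ∀ {i k}, i ≠ k → ∃ e ∈ path i, height e = sep i k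

namespace LeafSystem

variable {ι κ E : Type*}

/-- The leaf system of some of the leaves, possibly reordered. -/
def comap (S : LeafSystem ι E) (f : κ ↪ ι) : LeafSystem κ E where
  path i := S.path (f i)
  height := S.height
  sep i k := S.sep (f i) (f k)
  height_injOn _ := S.height_injOn _
  sep_comm _ _ := S.sep_comm _ _
  mem_iff h := S.mem_iff (f.injective.ne h)
  exists_height_eq h := S.exists_height_eq (f.injective.ne h)

/-- The series `∑ a(e) t^{h(e)}` over the edges on the path to the leaf `i`. -/
def series {A : Type*} [CommRing A] (S : LeafSystem ι E) (a : E → A) (i : ι) :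
    AddMonoidAlgebra A ℚ :=
  ∑ e ∈ S.path i, AddMonoidAlgebra.single (S.height e) (a e)

/-- `H` is the largest separation of two leaves, i.e. the height of their common root. -/
def IsTop (S : LeafSystem ι E) (H : ℚ) : Prop :=
  (∀ i k, i ≠ k → S.sep i k ≤ H) ∧ ∃ i k, i ≠ k ∧ S.sep i k = H

/-- Separations are ultrametric: an edge shared by `i, l` and by `l, k` is shared by `i, k`. -/
theorem sep_le_max (S : LeafSystem ι E) {i k l : ι} (hik : i ≠ k) (hil : i ≠ l) (hlk : l ≠ k) :
    S.sep i k ≤ max (S.sep i l) (S.sep l k) := by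
  by_contra h
  obtain ⟨h1, h2⟩ := max_lt_iff.1 (not_le.1 h)
  obtain ⟨e, he, heq⟩ := S.exists_height_eq hik
  have hl := (S.mem_iff hil e he).2 (heq ▸ h1)
  have hk := (S.mem_iff hlk e hl).2 (heq ▸ h2)
  exact (heq ▸ (S.mem_iff hik e he).1 hk).false

theorem IsTop.exists_edge {S : LeafSystem ι E} {H : ℚ} (hH : S.IsTop H) (i : ι) :
    ∃ e ∈ S.path i, S.height e = H := by
  obtain ⟨a, b, hab, h⟩ := hH.2
  have key : ∀ k, i ≠ k → S.sep i k = H → ∃ e ∈ S.path i, S.height e = H := by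
    intro k hk he
    simpa [he] using S.exists_height_eq hk
  by_cases ha : i = a
  · subst ha; exact key b hab h
  by_cases hb : i = b
  · subst hb; exact key a ha (by rw [S.sep_comm, h])
  rcases le_max_iff.1 (S.sep_le_max hab (Ne.symm ha) hb) with h1 | h1
  · exact key a ha (le_antisymm (hH.1 _ _ ha) (by rw [← h, S.sep_comm i a]; exact h1))
  · exact key b hb (le_antisymm (hH.1 _ _ hb) (by rw [← h]; exact h1))

section series

variable {A : Type*} [CommRing A] (S : LeafSystem ι E) (a : E → A)

theorem coeff_sum_single (s : Finset E) (h : E → ℚ) (q : ℚ) :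
    (∑ e ∈ s, AddMonoidAlgebra.single (h e) (a e)).coeff q = ∑ e ∈ s with h e = q, a e := by
  rw [AddMonoidAlgebra.coeff_sum, Finsupp.finsetSum_apply, Finset.sum_filter]
  exact Finset.sum_congr rfl fun e _ => by simp [Finsupp.single_apply]

theorem filter_height_eq {i : ι} {e : E} (he : e ∈ S.path i) :
    (S.path i).filter (fun e' => S.height e' = S.height e) = {e} := by
  ext e'
  simp only [Finset.mem_filter, Finset.mem_singleton]
  constructor
  · rintro ⟨h1, h2⟩
    exact S.height_injOn i h1 he h2
  · rintro rfl
    exact ⟨he, rfl⟩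

theorem filter_height_congr {i k : ι} (hik : i ≠ k) {q : ℚ} (hq : S.sep i k < q) :
    (S.path i).filter (fun e => S.height e = q) = (S.path k).filter (fun e => S.height e = q) := by
  ext e
  simp only [Finset.mem_filter]
  constructor
  · rintro ⟨h1, rfl⟩
    exact ⟨(S.mem_iff hik e h1).2 hq, rfl⟩
  · rintro ⟨h1, rfl⟩
    exact ⟨(S.mem_iff hik.symm e h1).2 (S.sep_comm i k ▸ hq), rfl⟩

/-- Above `sep i k` the two series agree. -/
theorem leadsAt_series_sub {i k : ι} (hik : i ≠ k) {e e' : E} (he : e ∈ S.path i)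
    (he' : e' ∈ S.path k) (h : S.height e = S.sep i k) (h' : S.height e' = S.sep i k) :
    LeadsAt (S.series a i - S.series a k) (S.sep i k) (a e - a e') := by
  constructor
  · rw [AddMonoidAlgebra.coeff_sub, Finsupp.sub_apply, series, series, coeff_sum_single,
      coeff_sum_single]
    conv_lhs => rw [← h, S.filter_height_eq he, h, ← h', S.filter_height_eq he']
    simp
  · intro p hp
    rw [AddMonoidAlgebra.coeff_sub, Finsupp.sub_apply, series, series, coeff_sum_single,
      coeff_sum_single, S.filter_height_congr hik hp, sub_self]

/-- The part of the series of `i` above the height `H`. -/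
def upper (H : ℚ) (i : ι) : AddMonoidAlgebra A ℚ :=
  ∑ e ∈ S.path i with H < S.height e, AddMonoidAlgebra.single (S.height e) (a e)

theorem leadsAt_series_sub_upper {H : ℚ} (hH : ∀ i k, i ≠ k → S.sep i k ≤ H) (o : ι) {i : ι}
    {e : E} (he : e ∈ S.path i) (h : S.height e = H) :
    LeadsAt (S.series a i - S.upper a H o) H (a e) := by
  constructor
  · rw [AddMonoidAlgebra.coeff_sub, Finsupp.sub_apply, series, upper, coeff_sum_single,
      coeff_sum_single, ← h, S.filter_height_eq he, Finset.filter_filter,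
      Finset.filter_false_of_mem (fun x _ hx => hx.1.ne' hx.2)]
    simp
  · intro p hp
    rw [AddMonoidAlgebra.coeff_sub, Finsupp.sub_apply, series, upper, coeff_sum_single,
      coeff_sum_single, Finset.filter_filter]
    have : (S.path o).filter (fun e => H < S.height e ∧ S.height e = p) =
        (S.path o).filter (fun e => S.height e = p) :=
      Finset.filter_congr fun x _ => ⟨fun h => h.2, fun h => ⟨h ▸ hp, h⟩⟩
    rw [this]
    by_cases hio : i = o
    · rw [hio, sub_self]
    · rw [S.filter_height_congr hio ((hH _ _ hio).trans_lt hp), sub_self]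

end series

section five

variable (S : LeafSystem (Fin 5) E)

/-- The determinant with the `a_j(e)` as variables. -/
def det : AddMonoidAlgebra (MvPolynomial (Fin 3 × E) ℂ) ℚ :=
  (quadMatrix fun j => S.series fun e => MvPolynomial.X (j, e)).det

/-- The coefficient found when each leaf `i + 1` is compared with an earlier leaf: `e i` and `e' i`
are the edges where the two paths separate, and `α i` is the edge at the root. -/
def leadCoeff (e e' : Fin 4 → E) (α : Fin 5 → E) (p : Fin 4 → Fin 5) :
    MvPolynomial (Fin 3 × E) ℂ :=
  (diffMatrix (fun j i => MvPolynomial.X (j, e i) - MvPolynomial.X (j, e' i))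
    (fun i => MvPolynomial.X (0, α i.succ) + MvPolynomial.X (0, α (p i)))).det

variable {S}

/-- The series of two leaves agree above their separation, and all series agree above `H`.  So the
difference of two series leads at the separation, and their sum, minus twice the common part above
`H`, leads at `H`. -/
theorem leadsAt_det {H : ℚ} (hH : ∀ i k, i ≠ k → S.sep i k ≤ H) {p : Fin 4 → Fin 5}
    (hp : ∀ i, p i < i.succ) {e e' : Fin 4 → E} {α : Fin 5 → E}
    (he : ∀ i, e i ∈ S.path i.succ ∧ S.height (e i) = S.sep i.succ (p i))
    (he' : ∀ i, e' i ∈ S.path (p i) ∧ S.height (e' i) = S.sep i.succ (p i))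
    (hα : ∀ i, α i ∈ S.path i ∧ S.height (α i) = H) :
    LeadsAt S.det (H + ∑ i, S.sep i.succ (p i)) (leadCoeff e e' α p) := by
  refine LeadsAt.det_quadMatrix (w := S.upper (fun e => MvPolynomial.X (0, e)) H 0) hp
    (fun j i => ?_) (fun i => ?_)
  · exact S.leadsAt_series_sub _ (hp i).ne' (he i).1 (he' i).1 (he i).2 (he' i).2
  · have h := fun k => S.leadsAt_series_sub_upper
      (fun e => MvPolynomial.X (R := ℂ) ((0 : Fin 3), e)) hH 0 (hα k).1 (hα k).2
    have := (h i.succ).add (h (p i))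
    convert this using 1
    ring

/-- For every choice of earlier leaves, `H + ∑ sep` bounds the degree of the determinant. -/
theorem exists_leadsAt_det {H : ℚ} (hH : S.IsTop H) {p : Fin 4 → Fin 5} (hp : ∀ i, p i < i.succ) :
    ∃ c, LeadsAt S.det (H + ∑ i, S.sep i.succ (p i)) c := by
  choose α hα using hH.exists_edge
  choose e he using fun i => S.exists_height_eq (hp i).ne'
  choose e' he' using fun i => S.exists_height_eq (hp i).ne
  exact ⟨_, leadsAt_det hH.1 hp he (fun i => ⟨(he' i).1, (he' i).2.trans (S.sep_comm _ _)⟩) hα⟩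

theorem leadCoeff_isHomogeneous (e e' : Fin 4 → E) (α : Fin 5 → E) (p : Fin 4 → Fin 5) :
    (leadCoeff e e' α p).IsHomogeneous 5 := by
  rw [leadCoeff, Matrix.det_apply]
  refine MvPolynomial.IsHomogeneous.sum _ _ _ fun σ _ => ?_
  set B := diffMatrix (fun j i => MvPolynomial.X (R := ℂ) (j, e i) - MvPolynomial.X (j, e' i))
    (fun i => MvPolynomial.X (0, α i.succ) + MvPolynomial.X (0, α (p i))) with hB
  have h : ∀ k i, (B k i).IsHomogeneous (![1, 2, 1, 1] k) := by
    have hX : ∀ x, (MvPolynomial.X x : MvPolynomial (Fin 3 × E) ℂ).IsHomogeneous 1 :=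
      fun x => MvPolynomial.isHomogeneous_X _ _
    intro k i
    fin_cases k
    · exact (hX _).sub (hX _)
    · exact ((hX _).sub (hX _)).mul ((hX _).add (hX _))
    · exact (hX _).sub (hX _)
    · exact (hX _).sub (hX _)
  have h1 := MvPolynomial.IsHomogeneous.prod Finset.univ (fun i => B (σ i) i) _
    fun i _ => h (σ i) i
  rw [Equiv.sum_comp σ ![1, 2, 1, 1]] at h1
  rcases Int.units_eq_one_or (Equiv.Perm.sign σ) with h2 | h2 <;> rw [h2]
  · simpa [Fin.sum_univ_four] using h1
  · simpa [Fin.sum_univ_four] using h1.neg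

/-- If the last two rows are unit vectors, a `2 × 2` minor remains. -/
theorem det_diffMatrix_single {R : Type*} [CommRing R] (v s : Fin 4 → R) (i : Fin 4) :
    (diffMatrix ![v, Pi.single (i + 2) 1, Pi.single (i + 3) 1] s).det =
      (-1) ^ (i : ℕ) * (v i * v (i + 1) * (s (i + 1) - s i)) := by
  fin_cases i <;>
  simp [diffMatrix, Matrix.det_succ_row_zero, Fin.sum_univ_succ, Fin.succAbove, Pi.single_apply] <;>
  ring

/-- Among the earlier leaves at the least distance from the leaf `i + 1`, the first one. -/
theorem exists_first_nearest (S : LeafSystem (Fin 5) E) (i : Fin 4) :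
    ∃ k < i.succ, (∀ l < i.succ, S.sep i.succ k ≤ S.sep i.succ l) ∧
      ∀ l < i.succ, S.sep i.succ l ≤ S.sep i.succ k → k ≤ l := by
  obtain ⟨k, hk, h⟩ := Finset.exists_min_image (Finset.Iio i.succ)
    (fun l => toLex (S.sep i.succ l, l)) ⟨0, by simp⟩
  refine ⟨k, Finset.mem_Iio.1 hk, fun l hl => ?_, fun l hl hle => ?_⟩
  · rcases Prod.Lex.toLex_le_toLex.1 (h l (Finset.mem_Iio.2 hl)) with h1 | h1
    · exact h1.le
    · exact h1.1.le
  · rcases Prod.Lex.toLex_le_toLex.1 (h l (Finset.mem_Iio.2 hl)) with h1 | h1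
    · exact absurd hle (not_le.2 h1)
    · exact h1.2

/-- If every leaf is compared with the first of the nearest earlier leaves, then the edges `e i` are
pairwise distinct and are different from all `e' i` and from the edge `α 0`.  So the `a_j(e i)` can
be prescribed while the other variables are `0`.  The column of the first leaf `i` whose path starts
with an edge other than `α 0` gets `s = 1`, all others get an even `s`, which makes two rows of the
matrix independent; the last two rows are unit vectors. -/
theorem leadCoeff_ne_zero {H : ℚ} (hH : S.IsTop H) {p : Fin 4 → Fin 5}
    (hp : ∀ i, p i < i.succ) (hmin : ∀ i, ∀ l < i.succ, S.sep i.succ (p i) ≤ S.sep i.succ l)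
    (hfirst : ∀ i, ∀ l < i.succ, S.sep i.succ l ≤ S.sep i.succ (p i) → p i ≤ l)
    {e e' : Fin 4 → E} {α : Fin 5 → E}
    (he : ∀ i, e i ∈ S.path i.succ ∧ S.height (e i) = S.sep i.succ (p i))
    (he' : ∀ i, e' i ∈ S.path (p i) ∧ S.height (e' i) = S.sep i.succ (p i))
    (hα : ∀ i, α i ∈ S.path i ∧ S.height (α i) = H) :
    leadCoeff e e' α p ≠ 0 := by
  classical
  have hA : ∀ i, ∀ k < i.succ, e i ∉ S.path k := fun i k hk hmem =>
    not_lt.2 (hmin i k hk) ((he i).2 ▸ (S.mem_iff hk.ne' _ (he i).1).1 hmem)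
  have hB : Function.Injective e := by
    intro i k hik
    rcases lt_trichotomy i k with h | h | h
    · exact absurd (hik ▸ (he i).1) (hA k _ (Fin.succ_lt_succ_iff.2 h))
    · exact h
    · exact absurd (hik ▸ (he k).1) (hA i _ (Fin.succ_lt_succ_iff.2 h))
  have hC : ∀ i k, e' i ≠ e k := by
    intro i k hik
    have h1 : k.succ ≤ p i := by
      by_contra h
      exact hA k _ (not_le.1 h) (hik ▸ (he' i).1)
    have h2 : p i = k.succ := by
      by_contra hne
      have h3 := (S.mem_iff (Ne.symm hne) _ (he k).1).1 (hik ▸ (he' i).1)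
      rw [← hik, (he' i).2] at h3
      have h4 := S.sep_le_max (h1.trans_lt (hp i)).ne' (hp i).ne' hne
      rw [S.sep_comm (p i), max_eq_left h3.le] at h4
      exact hne (le_antisymm (hfirst i _ (h1.trans_lt (hp i)) h4) h1)
    have h3 : S.sep k.succ (p k) = S.sep i.succ k.succ := by
      rw [← (he k).2, ← hik, (he' i).2, h2]
    have hlt : p k < i.succ := (hp k).trans (h2 ▸ hp i)
    have h4 := S.sep_le_max hlt.ne' (h2 ▸ hp i).ne' (hp k).ne'
    rw [h3, max_self, ← h2] at h4
    exact not_lt.2 (hfirst i _ hlt h4) (h2 ▸ hp k)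
  have hD : ∀ k, α 0 ≠ e k := fun k h => hA k 0 (Fin.succ_pos k) (h ▸ (hα 0).1)
  have hne : ∃ i : Fin 4, α i.succ ≠ α 0 := by
    by_contra! h
    have h' : ∀ k, α k = α 0 := fun k => Fin.cases rfl h k
    obtain ⟨a, b, hab, hs⟩ := hH.2
    have := (S.mem_iff hab _ (hα a).1).1 (by rw [h' a, ← h' b]; exact (hα b).1)
    rw [(hα a).2, hs] at this
    exact this.false
  obtain ⟨i, hi, hi'⟩ : ∃ i : Fin 4, α i.succ ≠ α 0 ∧ ∀ k < i.succ, α k = α 0 := by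
    obtain ⟨i, hi, h⟩ := WellFounded.has_min (wellFounded_lt (α := Fin 4))
      {i | α i.succ ≠ α 0} hne
    refine ⟨i, hi, fun k => Fin.cases (fun _ => rfl) (fun l hl => ?_) k⟩
    by_contra hl'
    exact h l hl' (Fin.succ_lt_succ_iff.1 hl)
  have hsep : ∀ a b, a ≠ b → S.sep a b < H → α a = α b := fun a b hab h =>
    S.height_injOn b ((S.mem_iff hab _ (hα a).1).2 ((hα a).2.symm ▸ h)) (hα b).1
      ((hα a).2.trans (hα b).2.symm)
  have hsepi : ∀ k < i.succ, S.sep i.succ k = H := by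
    intro k hk
    by_contra h
    exact hi ((hsep _ _ hk.ne' (lt_of_le_of_ne (hH.1 _ _ hk.ne') h)).trans (hi' k hk))
  have hei : e i = α i.succ := S.height_injOn _ (he i).1 (hα _).1
    ((he i).2.trans ((hsepi _ (hp i)).trans (hα _).2.symm))
  -- the values of `a_1`: `1` at `e i`, `2` at the other `e k`, and `0` elsewhere
  let v : Fin 4 → ℂ := fun k => if k = i then 1 else 2
  let ext (c : Fin 4 → ℂ) (x : E) : ℂ := ∑ k, if x = e k then c k else 0
  have ext_e : ∀ c k, ext c (e k) = c k := fun c k => by simp [ext, hB.eq_iff]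
  have ext_0 : ∀ c x, (∀ k, x ≠ e k) → ext c x = 0 := fun c x hx => by simp [ext, hx]
  have hev : ∀ x, ext v x = 0 ∨ ext v x = 1 ∨ ext v x = 2 := by
    intro x
    by_cases hx : ∃ k, x = e k
    · obtain ⟨k, rfl⟩ := hx
      rw [ext_e]
      by_cases hk : k = i <;> simp [v, hk]
    · exact Or.inl (ext_0 _ _ (by simpa using hx))
  let s : Fin 4 → ℂ := fun l => ext v (α l.succ) + ext v (α (p l))
  have hs1 : s i = 1 := by
    have : s i = ext v (e i) + ext v (α 0) := by rw [hei, ← hi' _ (hp i)]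
    rw [this, ext_e, ext_0 _ _ hD]
    simp [v]
  have hs2 : ∀ l, l ≠ i → s l ≠ 1 := by
    intro l hl
    rcases lt_or_eq_of_le (hH.1 _ _ (hp l).ne') with h | h
    · have : s l = 2 * ext v (α l.succ) := by
        change _ + _ = _
        rw [← hsep _ _ (hp l).ne' h]; ring
      rw [this]
      rcases hev (α l.succ) with h | h | h <;> rw [h] <;> norm_num
    · have h1 : e l = α l.succ := S.height_injOn _ (he l).1 (hα _).1
        ((he l).2.trans (h.trans (hα _).2.symm))
      have h2 : e' l = α (p l) := S.height_injOn _ (he' l).1 (hα _).1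
        ((he' l).2.trans (h.trans (hα _).2.symm))
      have : s l = 2 := by
        change _ + _ = _
        rw [← h1, ← h2, ext_e, ext_0 _ _ (hC l)]
        simp [v, hl]
      rw [this]; norm_num
  let a : Fin 3 → Fin 4 → ℂ := ![v, Pi.single (i + 2) 1, Pi.single (i + 3) 1]
  intro h0
  have h1 := congrArg (MvPolynomial.eval fun x : Fin 3 × E => ext (a x.1) x.2) h0
  rw [leadCoeff, RingHom.map_det, map_zero] at h1
  have h2 : (MvPolynomial.eval fun x : Fin 3 × E => ext (a x.1) x.2).mapMatrix
      (diffMatrix (fun j i => MvPolynomial.X (j, e i) - MvPolynomial.X (j, e' i))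
        (fun i => MvPolynomial.X (0, α i.succ) + MvPolynomial.X (0, α (p i)))) =
      diffMatrix a s := by
    ext k l
    fin_cases k <;> simp [diffMatrix, ext_e, ext_0 _ _ (hC _), a, s]
  have hii : i + 1 ≠ i := (by decide : ∀ i : Fin 4, i + 1 ≠ i) i
  rw [h2, det_diffMatrix_single] at h1
  refine mul_ne_zero (pow_ne_zero _ (by norm_num)) (mul_ne_zero (mul_ne_zero ?_ ?_) ?_) h1
  · simp [v]
  · simp [v, hii]
  · rw [hs1]
    exact sub_ne_zero.2 (hs2 _ hii)

/-- The generic determinant of a leaf system: its degree is `H` plus the separations of the leaves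
`1, …, 4` from their nearest earlier leaves. -/
theorem exists_leadCoeff {H : ℚ} (hH : S.IsTop H) {p : Fin 4 → Fin 5}
    (hp : ∀ i, p i < i.succ) (hmin : ∀ i, ∀ l < i.succ, S.sep i.succ (p i) ≤ S.sep i.succ l) :
    ∃ c : MvPolynomial (Fin 3 × E) ℂ, c ≠ 0 ∧ c.IsHomogeneous 5 ∧
      LeadsAt S.det (H + ∑ i, S.sep i.succ (p i)) c := by
  choose q hq hqmin hqfirst using S.exists_first_nearest
  choose α hα using hH.exists_edge
  choose e he using fun i => S.exists_height_eq (hq i).ne'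
  choose e' he' using fun i => S.exists_height_eq (hq i).ne
  have he'' := fun i => (⟨(he' i).1, (he' i).2.trans (S.sep_comm _ _)⟩ :
    e' i ∈ S.path (q i) ∧ S.height (e' i) = S.sep i.succ (q i))
  refine ⟨leadCoeff e e' α q, leadCoeff_ne_zero hH hq hqmin hqfirst he he'' hα,
    leadCoeff_isHomogeneous _ _ _ _, ?_⟩
  have hpq : ∀ i, S.sep i.succ (p i) = S.sep i.succ (q i) := fun i =>
    le_antisymm (hmin i _ (hq i)) (hqmin i _ (hp i))
  simp only [hpq]
  exact leadsAt_det hH.1 hq he he'' hα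

end five

end LeafSystem

/-! ### Ultrametrics -/

/-- The strong triangle inequality for a symmetric function on pairs of distinct points.  The values
need not be positive, and those on the diagonal are irrelevant. -/
def IsUltrametric {ι R : Type*} [LinearOrder R] (U : ι → ι → R) : Prop :=
  (∀ i k, U i k = U k i) ∧ ∀ i k l, i ≠ k → i ≠ l → l ≠ k → U i k ≤ max (U i l) (U l k)

namespace IsUltrametric

variable {ι R : Type*} [LinearOrder R] {U : ι → ι → R}

theorem lt_trans' (hU : IsUltrametric U) {q : R} {i k l : ι} (h1 : i = k ∨ U i k < q)
    (h2 : k = l ∨ U k l < q) : i = l ∨ U i l < q := by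
  rcases h1 with rfl | h1
  · exact h2
  rcases h2 with rfl | h2
  · exact Or.inr h1
  by_cases hil : i = l
  · exact Or.inl hil
  by_cases hik : i = k
  · subst hik; exact Or.inr h2
  by_cases hkl : k = l
  · subst hkl; exact Or.inr h1
  exact Or.inr ((hU.2 i l k hil hik hkl).trans_lt (max_lt h1 h2))

theorem lt_symm (hU : IsUltrametric U) {q : R} {i k : ι} (h1 : i = k ∨ U i k < q) :
    k = i ∨ U k i < q :=
  h1.imp Eq.symm fun h => by rwa [hU.1 k i]

theorem map {R' : Type*} [LinearOrder R'] (hU : IsUltrametric U) {f : R → R'} (hf : Monotone f) :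
    IsUltrametric fun i k => f (U i k) :=
  ⟨fun i k => congrArg f (hU.1 i k), fun i k l h1 h2 h3 => by
    rw [← hf.map_max]; exact hf (hU.2 i k l h1 h2 h3)⟩

end IsUltrametric

/-- The least element of the open ball of radius `q` about `i`. -/
def ballMin {n : ℕ} (U : Fin n → Fin n → ℚ) (q : ℚ) (i : Fin n) : Fin n :=
  (Finset.univ.filter fun k => i = k ∨ U i k < q).min' ⟨i, by simp⟩

theorem ballMin_eq_iff {n : ℕ} {U : Fin n → Fin n → ℚ} (hU : IsUltrametric U) (q : ℚ)
    (i k : Fin n) : ballMin U q i = ballMin U q k ↔ i = k ∨ U i k < q := by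
  have hmem : ∀ i, i = ballMin U q i ∨ U i (ballMin U q i) < q := fun i =>
    (Finset.mem_filter.1 (Finset.min'_mem (Finset.univ.filter fun k => i = k ∨ U i k < q)
      ⟨i, by simp⟩)).2
  constructor
  · intro h
    exact hU.lt_trans' (hmem i) (h ▸ hU.lt_symm (hmem k))
  · intro h
    unfold ballMin
    congr 1
    ext l
    simp only [Finset.mem_filter, Finset.mem_univ, true_and]
    exact ⟨fun h' => hU.lt_trans' (hU.lt_symm h) h', fun h' => hU.lt_trans' h h'⟩

/-- The points of a finite ultrametric space can be ordered in such a way that balls become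
intervals: sort by the sequence of the balls about a point, from the largest to the smallest. -/
theorem IsUltrametric.exists_planar {n : ℕ} {U : Fin n → Fin n → ℚ} (hU : IsUltrametric U) :
    ∃ τ : Equiv.Perm (Fin n), ∀ a b c, a < b → b < c → U (τ b) (τ c) ≤ U (τ a) (τ c) := by
  let Q : Finset ℚ := Finset.univ.image fun x : Fin n × Fin n => U x.1 x.2
  let f : Fin n → Lex (Qᵒᵈ → Fin n) := fun i =>
    toLex fun q => ballMin U (OrderDual.ofDual q : Q) i
  refine ⟨Tuple.sort f, fun a b c hab hbc => ?_⟩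
  have h1 : f _ ≤ f _ := Tuple.monotone_sort f hab.le
  have h2 : f _ ≤ f _ := Tuple.monotone_sort f hbc.le
  have nab : Tuple.sort f a ≠ Tuple.sort f b := (Tuple.sort f).injective.ne hab.ne
  have nbc : Tuple.sort f b ≠ Tuple.sort f c := (Tuple.sort f).injective.ne hbc.ne
  have nac : Tuple.sort f a ≠ Tuple.sort f c := (Tuple.sort f).injective.ne (hab.trans hbc).ne
  generalize Tuple.sort f a = x at *
  generalize Tuple.sort f b = y at *
  generalize Tuple.sort f c = z at *
  by_contra hlt
  rw [not_le] at hlt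
  have hyx : U x y ≤ U y z := by
    rw [hU.1 y z] at hlt ⊢
    exact (hU.2 x y z nab nac nbc.symm).trans (max_le hlt.le le_rfl)
  let q₀ : Qᵒᵈ := OrderDual.toDual ⟨U y z, Finset.mem_image.2 ⟨(y, z), by simp, rfl⟩⟩
  have key : ∀ {u v : Fin n}, f u ≤ f v → U u v ≤ U y z → ballMin U (U y z) u ≤ ballMin U (U y z) v := by
    intro u v huv hle
    by_contra h
    refine not_lt.2 huv ⟨q₀, fun q hq => ?_, not_le.1 h⟩
    exact ((ballMin_eq_iff hU _ u v).2 (Or.inr (hle.trans_lt hq))).symm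
  have h3 := key h1 hyx
  have h4 := key h2 le_rfl
  have h5 := (ballMin_eq_iff hU (U y z) x z).2 (Or.inr hlt)
  have h6 := (ballMin_eq_iff hU (U y z) y z).1 (le_antisymm h4 (h5 ▸ h3))
  simp [nbc] at h6

/-- The leaf system of a finite ultrametric space: for each value `q` of the metric there is one edge
at height `q` above each ball of radius `q`. -/
def IsUltrametric.leafSystem {n : ℕ} {U : Fin n → Fin n → ℚ} (hU : IsUltrametric U) :
    LeafSystem (Fin n) (ℚ × Fin n) where
  path i := (Finset.univ.image fun x : Fin n × Fin n => U x.1 x.2).image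
    fun q => (q, ballMin U q i)
  height := Prod.fst
  sep := U
  height_injOn i := by
    rintro ⟨q, m⟩ h1 ⟨q', m'⟩ h2 h
    simp only [Finset.coe_image, Set.mem_image, Prod.mk.injEq] at h1 h2 h
    obtain ⟨_, _, rfl, rfl⟩ := h1
    obtain ⟨_, _, rfl, rfl⟩ := h2
    rw [h]
  sep_comm := hU.1
  mem_iff := by
    intro i k hik e he
    obtain ⟨q, hq, rfl⟩ := Finset.mem_image.1 he
    rw [Finset.mem_image]
    constructor
    · rintro ⟨q', hq', h⟩
      obtain ⟨rfl, h⟩ := Prod.mk.inj h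
      exact ((ballMin_eq_iff hU _ _ _).1 h.symm).resolve_left hik
    · intro h
      exact ⟨q, hq, by rw [(ballMin_eq_iff hU q i k).2 (Or.inr h)]⟩
  exists_height_eq := by
    intro i k _
    exact ⟨(U i k, ballMin U (U i k) i), Finset.mem_image.2 ⟨_, Finset.mem_image.2
      ⟨(i, k), by simp, rfl⟩, rfl⟩, rfl⟩

namespace LeafSystem

variable {ι E : Type*}

theorem isUltrametric (S : LeafSystem ι E) : IsUltrametric S.sep :=
  ⟨S.sep_comm, fun _ _ _ h1 h2 h3 => S.sep_le_max h1 h2 h3⟩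

theorem exists_isTop (S : LeafSystem (Fin 5) E) : ∃ H, S.IsTop H := by
  obtain ⟨x, hx, h⟩ := Finset.exists_max_image (Finset.univ.filter fun x : Fin 5 × Fin 5 => x.1 ≠ x.2)
    (fun x => S.sep x.1 x.2) ⟨(0, 1), by simp⟩
  exact ⟨S.sep x.1 x.2, fun i k hik => h (i, k) (by simpa using hik), x.1, x.2,
    by simpa using hx, rfl⟩

theorem det_comap_perm (S : LeafSystem (Fin 5) E) (π : Equiv.Perm (Fin 5)) :
    (S.comap π.toEmbedding).det = Equiv.Perm.sign π • S.det := by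
  have h := Matrix.det_permute' π
    (quadMatrix fun j => S.series fun e => MvPolynomial.X (R := ℂ) (j, e))
  rw [← quadMatrix_comp] at h
  rw [det, det, Units.smul_def, zsmul_eq_mul, ← h]
  rfl

theorem IsTop.comap_perm {S : LeafSystem (Fin 5) E} {H : ℚ} (h : S.IsTop H)
    (π : Equiv.Perm (Fin 5)) : (S.comap π.toEmbedding).IsTop H := by
  refine ⟨fun i k hik => h.1 _ _ (π.injective.ne hik), ?_⟩
  obtain ⟨i, k, hik, hs⟩ := h.2
  exact ⟨π.symm i, π.symm k, π.symm.injective.ne hik, by simpa [comap] using hs⟩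

/-- A closed tour through all leaves has a step of length at least `H`. -/
theorem IsTop.exists_le_step {S : LeafSystem (Fin 5) E} {H : ℚ} (h : S.IsTop H) :
    ∃ m : Fin 5, H ≤ S.sep m (m + 1) := by
  by_contra! hlt
  have hstep : ∀ m : Fin 5, m = m + 1 ∨ S.sep m (m + 1) < H := fun m => Or.inr (hlt m)
  have hU := S.isUltrametric
  have key : ∀ d a : Fin 5, a = a + d ∨ S.sep a (a + d) < H := by
    intro d
    induction d using Fin.induction with
    | zero => intro a; simp
    | succ d ih =>
      intro a
      have : a + d.succ = (a + d.castSucc) + 1 := by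
        rw [add_assoc, Fin.coeSucc_eq_succ]
      rw [this]
      exact hU.lt_trans' (ih a) (hstep _)
  obtain ⟨i, k, hik, hs⟩ := h.2
  rcases key (k - i) i with h1 | h1
  · exact hik (by simpa using h1)
  · rw [add_sub_cancel, hs] at h1
    exact h1.false

/-- The cyclic permutations of `Fin 5` are the conjugates of the rotation. -/
theorem exists_eq_conj {σ : Equiv.Perm (Fin 5)} (hσ : σ.IsCycle ∧ σ.support = Finset.univ) :
    ∃ τ : Equiv.Perm (Fin 5), ∀ a, σ (τ a) = τ (a + 1) := by
  have h := hσ.1.isConj (isCycle_finRotate (n := 3)) (by rw [hσ.2, support_finRotate])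
  obtain ⟨τ, hτ⟩ := isConj_iff.1 h.symm
  refine ⟨τ, fun a => ?_⟩
  rw [← hτ]
  simp [finRotate_apply]

theorem isCycle_conj (τ : Equiv.Perm (Fin 5)) :
    (τ * finRotate 5 * τ⁻¹).IsCycle ∧ (τ * finRotate 5 * τ⁻¹).support = Finset.univ := by
  refine ⟨(isCycle_finRotate (n := 3)).conj, ?_⟩
  rw [Equiv.Perm.support_conj, support_finRotate]
  simp

/-- The degree of the determinant is the length of a shortest closed tour through the five leaves.
No tour is shorter: order the leaves along the tour, starting after a longest step.  For the converse
choose a planar order of the leaves. -/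
theorem exists_leadsAt_det_tour (S : LeafSystem (Fin 5) E) :
    ∃ (D : ℚ) (c : MvPolynomial (Fin 3 × E) ℂ), c ≠ 0 ∧ LeadsAt S.det D c ∧
      (∀ σ : Equiv.Perm (Fin 5), σ.IsCycle ∧ σ.support = Finset.univ →
        D ≤ ∑ a, S.sep a (σ a)) ∧
      ∃ σ : Equiv.Perm (Fin 5), (σ.IsCycle ∧ σ.support = Finset.univ) ∧
        ∑ a, S.sep a (σ a) ≤ D := by
  obtain ⟨H, hH⟩ := S.exists_isTop
  obtain ⟨τ, hτ⟩ := S.isUltrametric.exists_planar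
  have hlt : ∀ i : Fin 4, i.castSucc < i.succ := fun i => Fin.castSucc_lt_succ
  obtain ⟨c, hc, -, hlead⟩ := exists_leadCoeff (hH.comap_perm τ) hlt (by
    intro i l hl
    rcases (Fin.le_castSucc_iff.2 hl).lt_or_eq with h | rfl
    · change S.sep _ _ ≤ S.sep _ _
      rw [S.sep_comm, S.sep_comm (τ.toEmbedding i.succ)]
      exact hτ _ _ _ h (hlt i)
    · rfl)
  set D := H + ∑ i : Fin 4, (S.comap τ.toEmbedding).sep i.succ i.castSucc
  have hdet : ∀ π : Equiv.Perm (Fin 5), S.det =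
      Equiv.Perm.sign π • (S.comap π.toEmbedding).det := by
    intro π
    rw [det_comap_perm, smul_smul, Int.units_mul_self, one_smul]
  have hc' : Equiv.Perm.sign τ • c ≠ 0 := by
    rcases Int.units_eq_one_or (Equiv.Perm.sign τ) with h | h <;> simpa [h] using hc
  have hlead' : LeadsAt S.det D (Equiv.Perm.sign τ • c) := by
    rw [hdet τ]
    exact hlead.units_smul _
  refine ⟨D, _, hc', hlead', fun σ hσ => ?_, τ * finRotate 5 * τ⁻¹, isCycle_conj τ, ?_⟩
  · obtain ⟨ρ, hρ⟩ := exists_eq_conj hσ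
    obtain ⟨m, hm⟩ := (hH.comap_perm ρ).exists_le_step
    let π : Equiv.Perm (Fin 5) := (Equiv.addRight (m + 1)).trans ρ
    obtain ⟨c', hlead2⟩ := exists_leadsAt_det (hH.comap_perm π) hlt
    have h1 := hlead'.le_of_ne_zero hc' (by rw [hdet π]; exact hlead2.units_smul _)
    refine h1.trans ?_
    rw [← Equiv.sum_comp π]
    have h2 : ∀ a, σ (π a) = π (a + 1) := by
      intro a
      simp only [π, Equiv.trans_apply, Equiv.coe_addRight, hρ]
      rw [add_right_comm]
    simp only [h2, Fin.sum_univ_castSucc (n := 4)]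
    rw [add_comm]
    refine add_le_add (Finset.sum_le_sum fun i _ => ?_) ?_
    · rw [Fin.coeSucc_eq_succ, S.sep_comm]
      rfl
    · have h3 : π (Fin.last 4) = ρ m :=
        congrArg ρ ((by decide : ∀ m : Fin 5, Fin.last 4 + (m + 1) = m) m)
      have h4 : π (Fin.last 4 + 1) = ρ (m + 1) := by
        simp [π]
      rw [h3, h4]
      exact hm
  · rw [← Equiv.sum_comp τ]
    simp only [Equiv.Perm.mul_apply, Equiv.Perm.coe_inv, Equiv.symm_apply_apply, finRotate_apply,
      Fin.sum_univ_castSucc (n := 4)]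
    rw [add_comm]
    refine add_le_add (hH.1 _ _ (τ.injective.ne (by simp))) (Finset.sum_le_sum fun i _ => ?_)
    rw [Fin.coeSucc_eq_succ, S.sep_comm]
    rfl

end LeafSystem

/-! ### From finite sums of powers of `t` to Puiseux series -/

/-- The monomial `c t^q` as a Puiseux series. -/
def puiseuxSingle (q : ℚ) (c : ℂ) : puiseuxField :=
  ⟨HahnSeries.single q c, q.den, q.pos, fun p hp => ⟨q.num, by
    rw [Set.mem_singleton_iff.1 (HahnSeries.support_single_subset hp), Rat.num_div_den]⟩⟩

/-- The substitution `t ↦ t⁻¹` from `ℂ[t^ℚ]` to the Puiseux series, which turns the degree into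
minus the valuation. -/
def toPuiseux : AddMonoidAlgebra ℂ ℚ →+* puiseuxField :=
  AddMonoidAlgebra.liftNCRingHom
    ((HahnSeries.C : ℂ →+* HahnSeries ℚ ℂ).codRestrict puiseuxField fun c =>
      (puiseuxSingle 0 c).2)
    { toFun := fun q => puiseuxSingle (-q.toAdd) 1
      map_one' := Subtype.ext rfl
      map_mul' := fun p q => Subtype.ext (by
        simp [puiseuxSingle, HahnSeries.single_mul_single, add_comm]) }
    (fun _ _ => Commute.all _ _)

theorem coeff_toPuiseux (f : AddMonoidAlgebra ℂ ℚ) (q : ℚ) :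
    (toPuiseux f : HahnSeries ℚ ℂ).coeff q = f.coeff (-q) := by
  induction f using AddMonoidAlgebra.induction_linear with
  | zero => simp
  | add f g hf hg => simp [hf, hg]
  | single p c =>
    have : (toPuiseux (AddMonoidAlgebra.single p c) : HahnSeries ℚ ℂ) = HahnSeries.single (-p) c := by
      refine (congrArg Subtype.val (AddMonoidAlgebra.liftNC_single _ _ _ _)).trans ?_
      change HahnSeries.C c * HahnSeries.single (-p) 1 = _
      rw [HahnSeries.C_apply, HahnSeries.single_mul_single, zero_add, mul_one]
    rw [this, AddMonoidAlgebra.coeff_single]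
    by_cases h : q = -p
    · subst h; simp
    · rw [HahnSeries.coeff_single_of_ne h, Finsupp.single_eq_of_ne fun h' => h (by rw [← h', neg_neg])]

theorem LeadsAt.puiseuxVal_toPuiseux {f : AddMonoidAlgebra ℂ ℚ} {q : ℚ} {c : ℂ} (h : LeadsAt f q c)
    (hc : c ≠ 0) : toPuiseux f ≠ 0 ∧ puiseuxVal (toPuiseux f) = -q := by
  have h1 : (toPuiseux f : HahnSeries ℚ ℂ).coeff (-q) ≠ 0 := by
    rw [coeff_toPuiseux, neg_neg, h.1]
    exact hc
  have h0 : (toPuiseux f : HahnSeries ℚ ℂ) ≠ 0 := fun h0 => h1 (by rw [h0]; simp)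
  refine ⟨fun h0' => h0 (by rw [h0']; rfl),
    le_antisymm (HahnSeries.order_le_of_coeff_ne_zero h1) ?_⟩
  by_contra hlt
  have h2 := HahnSeries.coeff_order_eq_zero.not.2 h0
  rw [coeff_toPuiseux] at h2
  refine h2 (h.2 _ ?_)
  have : puiseuxVal (toPuiseux f) < -q := not_le.1 hlt
  unfold puiseuxVal at this
  linarith

theorem LeadsAt.map {A B : Type*} [CommRing A] [CommRing B] (φ : A →+* B)
    {f : AddMonoidAlgebra A ℚ} {q : ℚ} {c : A} (h : LeadsAt f q c) :
    LeadsAt (AddMonoidAlgebra.mapRingHom ℚ φ f) q (φ c) :=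
  ⟨by simp [h.1], fun p hp => by simp [h.2 p hp]⟩

theorem map_quadMatrix {R R' κ : Type*} [CommRing R] [CommRing R'] (φ : R →+* R')
    (x : Fin 3 → κ → R) : (quadMatrix x).map φ = quadMatrix fun j i => φ (x j i) := by
  ext k i
  fin_cases k <;> simp [quadMatrix]

theorem LeafSystem.mapRingHom_series {ι E A B : Type*} [CommRing A] [CommRing B] (φ : A →+* B)
    (S : LeafSystem ι E) (a : E → A) (i : ι) :
    AddMonoidAlgebra.mapRingHom ℚ φ (S.series a i) = S.series (fun e => φ (a e)) i := by
  simp [LeafSystem.series]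

/-- Specialization of the variables. -/
theorem LeafSystem.mapRingHom_det {E : Type*} (S : LeafSystem (Fin 5) E) (a : Fin 3 × E → ℂ) :
    AddMonoidAlgebra.mapRingHom ℚ (MvPolynomial.eval a) S.det =
      (quadMatrix fun j => S.series fun e => a (j, e)).det := by
  rw [LeafSystem.det, RingHom.map_det, RingHom.mapMatrix_apply, map_quadMatrix]
  simp [LeafSystem.mapRingHom_series]

/-! ### Points of the tropical Grassmannian from ultrametrics -/

/-- The maximal minors of a matrix satisfy all relations in the Grassmannian ideal. -/
theorem eval_minors_eq_zero {m n : ℕ} (N : Matrix (Fin m) (Fin n) puiseuxField)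
    {f : MvPolynomial (Fin m ↪o Fin n) puiseuxField} (hf : f ∈ grassmannIdeal m n) :
    MvPolynomial.eval (fun s : Fin m ↪o Fin n => (N.submatrix id s).det) f = 0 := by
  let ev : MvPolynomial (Fin m × Fin n) puiseuxField →+* puiseuxField :=
    MvPolynomial.eval fun x => N x.1 x.2
  let g : (Fin m ↪o Fin n) → MvPolynomial (Fin m × Fin n) puiseuxField := fun s =>
    ((Matrix.mvPolynomialX (Fin m) (Fin n) puiseuxField).submatrix id s).det
  have hcomp : MvPolynomial.eval (fun s : Fin m ↪o Fin n => (N.submatrix id s).det) =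
      ev.comp (MvPolynomial.aeval (R := puiseuxField) g : _ →ₐ[puiseuxField] _).toRingHom := by
    refine MvPolynomial.ringHom_ext (fun c => ?_) fun s => ?_
    · simp [ev]
    · simp only [MvPolynomial.eval_X, RingHom.comp_apply, AlgHom.toRingHom_eq_coe,
        RingHom.coe_coe, MvPolynomial.aeval_X, g, RingHom.map_det, ev]
      congr 1
      ext a b
      simp
  have h0 : MvPolynomial.aeval (R := puiseuxField) g f = 0 := hf
  rw [hcomp]
  change ev (MvPolynomial.aeval g f) = 0
  rw [h0, map_zero]

theorem MvPolynomial.exists_eval_ne_zero {σ ι : Type*} [Fintype ι] (c : ι → MvPolynomial σ ℂ)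
    (hc : ∀ i, c i ≠ 0) : ∃ a : σ → ℂ, ∀ i, MvPolynomial.eval a (c i) ≠ 0 := by
  by_contra! h
  refine Finset.prod_ne_zero_iff.2 (fun i _ => hc i) (MvPolynomial.funext fun a => ?_ :
    ∏ i, c i = 0)
  obtain ⟨i, hi⟩ := h a
  rw [map_prod, map_zero]
  exact Finset.prod_eq_zero (Finset.mem_univ i) hi

/-- The value of `φ⁽⁵⁾`, from a shortest closed tour. -/
theorem phi_eq {n : ℕ} (X : (Fin 2 ↪o Fin n) → ℝ) (s : Fin 5 ↪o Fin n) {d : ℝ}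
    (h : ∀ σ : Equiv.Perm (Fin 5), σ.IsCycle ∧ σ.support = Finset.univ →
      2 * d ≤ ∑ a, pairEntry X (s a) (s (σ a)))
    (h' : ∃ σ : Equiv.Perm (Fin 5), (σ.IsCycle ∧ σ.support = Finset.univ) ∧
      ∑ a, pairEntry X (s a) (s (σ a)) ≤ 2 * d) : phi 5 n X s = d := by
  obtain ⟨σ, hσ, hle⟩ := h'
  have : (⨅ σ : {σ : Equiv.Perm (Fin 5) // σ.IsCycle ∧ σ.support = Finset.univ},
      ∑ a, pairEntry X (s a) (s (σ.1 a))) = 2 * d := by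
    have : Nonempty {σ : Equiv.Perm (Fin 5) // σ.IsCycle ∧ σ.support = Finset.univ} := ⟨⟨σ, hσ⟩⟩
    refine le_antisymm ((ciInf_le (Set.finite_range _).bddBelow ⟨σ, hσ⟩).trans hle)
      (le_ciInf fun σ => h σ.1 σ.2)
  rw [phi, this]
  ring

theorem pairEntry_of_symm {n : ℕ} {X : (Fin 2 ↪o Fin n) → ℝ} {Y : Fin n → Fin n → ℝ}
    (hY : ∀ i k, Y i k = Y k i) (hX : ∀ s, X s = Y (s 0) (s 1)) {i k : Fin n} (hik : i ≠ k) :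
    pairEntry X i k = Y i k := by
  unfold pairEntry
  rcases lt_or_gt_of_ne hik with h | h
  · rw [dif_pos h, hX]
    rfl
  · rw [dif_neg (not_lt.2 h.le), dif_pos h, hX, hY]
    rfl

/-- The core of the inclusions: for a rational ultrametric `U` on the leaves, changed by rational
weights `w` of the leaves, the minors of the matrix with columns `t^w (1, x, x², y, z)` for generic
coefficients have the degrees prescribed by `φ⁽⁵⁾`, and `t ↦ t⁻¹` turns these into valuations. -/
theorem phi_mem_tropicalGrassmannian_of_rat {n : ℕ} {U : Fin n → Fin n → ℚ}
    (hU : IsUltrametric U) (w : Fin n → ℚ) :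
    phi 5 n (fun s => ((2 * U (s 0) (s 1) + w (s 0) + w (s 1) : ℚ) : ℝ)) ∈
      tropicalGrassmannian 5 n := by
  classical
  have : Fintype (Fin 5 ↪o Fin n) := Fintype.ofInjective (fun s => (s : Fin 5 → Fin n))
    DFunLike.coe_injective
  let S := hU.leafSystem
  choose D c hc hlead hge hle using fun s : Fin 5 ↪o Fin n =>
    (S.comap s.toEmbedding).exists_leadsAt_det_tour
  obtain ⟨a, ha⟩ := MvPolynomial.exists_eval_ne_zero c hc
  let x : Fin 3 → Fin n → AddMonoidAlgebra ℂ ℚ := fun j => S.series fun e => a (j, e)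
  let N : Matrix (Fin 5) (Fin n) (AddMonoidAlgebra ℂ ℚ) := Matrix.of fun k i =>
    AddMonoidAlgebra.single (w i) 1 * quadMatrix x k i
  have hN : ∀ s : Fin 5 ↪o Fin n, LeadsAt (N.submatrix id s).det (∑ i, w (s i) + D s)
      (MvPolynomial.eval a (c s)) := by
    intro s
    have h1 : (N.submatrix id s).det = (∏ i, AddMonoidAlgebra.single (w (s i)) 1) *
        (quadMatrix fun j i => x j (s i)).det := by
      rw [quadMatrix_comp, ← Matrix.det_mul_row]
      rfl
    have h2 := (hlead s).map (MvPolynomial.eval a)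
    rw [LeafSystem.mapRingHom_det] at h2
    rw [h1]
    have h3 := (LeadsAt.prod (A := ℂ) Finset.univ fun (i : Fin 5) _ =>
      LeadsAt.single (w (s i)) 1).mul h2
    simp only [Finset.prod_const_one, one_mul] at h3
    exact h3
  have hdet : ∀ s : Fin 5 ↪o Fin n, ((N.map toPuiseux).submatrix id s).det =
      toPuiseux (N.submatrix id s).det := fun s => by
    rw [RingHom.map_det]; rfl
  refine subset_closure ⟨fun s => ((N.map toPuiseux).submatrix id s).det, ?_, ?_, ?_⟩
  · intro s
    simp only [hdet]
    exact ((hN s).puiseuxVal_toPuiseux (ha s)).1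
  · exact fun f hf => eval_minors_eq_zero _ hf
  · intro s
    simp only [hdet]
    rw [((hN s).puiseuxVal_toPuiseux (ha s)).2, neg_neg]
    have hsum : ∀ σ : Equiv.Perm (Fin 5), σ.IsCycle ∧ σ.support = Finset.univ →
        ∑ b, pairEntry (fun s => ((2 * U (s 0) (s 1) + w (s 0) + w (s 1) : ℚ) : ℝ)) (s b)
          (s (σ b)) =
        ((2 * (∑ b, (S.comap s.toEmbedding).sep b (σ b) + ∑ b, w (s b)) : ℚ) : ℝ) := by
      intro σ hσ
      have h1 : ∀ b, pairEntry (fun s => ((2 * U (s 0) (s 1) + w (s 0) + w (s 1) : ℚ) : ℝ)) (s b)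
          (s (σ b)) = ((2 * U (s b) (s (σ b)) + w (s b) + w (s (σ b)) : ℚ) : ℝ) := by
        intro b
        refine pairEntry_of_symm (Y := fun i k => ((2 * U i k + w i + w k : ℚ) : ℝ))
          (fun i k => ?_) (fun _ => rfl) (s.injective.ne ?_)
        · rw [hU.1 i k, add_right_comm]
        · have : b ∈ σ.support := hσ.2 ▸ Finset.mem_univ b
          exact (Equiv.Perm.mem_support.1 this).symm
      simp only [h1]
      rw [← Rat.cast_sum, Finset.sum_add_distrib, Finset.sum_add_distrib, ← Finset.mul_sum,
        Equiv.sum_comp σ fun b => w (s b)]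
      congr 1
      change 2 * _ + _ + _ = 2 * (∑ b, U (s b) (s (σ b)) + _)
      ring
    refine phi_eq _ s (fun σ hσ => ?_) ?_
    · rw [hsum σ hσ]
      have := hge s σ hσ
      exact_mod_cast (by linarith : 2 * (∑ i, w (s i) + D s) ≤
        2 * (∑ b, (S.comap s.toEmbedding).sep b (σ b) + ∑ b, w (s b)))
    · obtain ⟨σ, hσ, h⟩ := hle s
      refine ⟨σ, hσ, ?_⟩
      rw [hsum σ hσ]
      exact_mod_cast (by linarith : 2 * (∑ b, (S.comap s.toEmbedding).sep b (σ b) +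
        ∑ b, w (s b)) ≤ 2 * (∑ i, w (s i) + D s))

/-! ### The four-point condition -/

/-- The four-point condition: among the three sums `X_{ij} + X_{kl}`, `X_{ik} + X_{jl}`,
`X_{il} + X_{jk}` the maximum is attained at least twice. -/
def FourPoint {n : ℕ} (X : (Fin 2 ↪o Fin n) → ℝ) : Prop :=
  ∀ i j k l, i ≠ j → i ≠ k → i ≠ l → j ≠ k → j ≠ l → k ≠ l →
    pairEntry X i j + pairEntry X k l ≤
      max (pairEntry X i k + pairEntry X j l) (pairEntry X i l + pairEntry X j k)

theorem pairEntry_comm {n : ℕ} (X : (Fin 2 ↪o Fin n) → ℝ) (i k : Fin n) :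
    pairEntry X i k = pairEntry X k i := by
  unfold pairEntry
  rcases lt_trichotomy i k with h | rfl | h
  · simp [h, h.le]
  · rfl
  · simp [h, h.le]

theorem increasingPair_eta {n : ℕ} (s : Fin 2 ↪o Fin n) (h : s 0 < s 1) :
    increasingPair (s 0) (s 1) h = s := by
  ext a
  fin_cases a <;> rfl

theorem eq_pairEntry {n : ℕ} (X : (Fin 2 ↪o Fin n) → ℝ) (s : Fin 2 ↪o Fin n) :
    X s = pairEntry X (s 0) (s 1) := by
  have h : s 0 < s 1 := s.strictMono (by decide)
  rw [pairEntry, dif_pos h, increasingPair_eta]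

theorem continuous_pairEntry {n : ℕ} (i k : Fin n) :
    Continuous fun X : (Fin 2 ↪o Fin n) → ℝ => pairEntry X i k := by
  unfold pairEntry
  split_ifs <;> fun_prop

theorem continuous_phi (m n : ℕ) : Continuous (phi m n) := by
  classical
  refine continuous_pi fun s => continuous_const.mul ?_
  rcases isEmpty_or_nonempty {σ : Equiv.Perm (Fin m) // σ.IsCycle ∧ σ.support = Finset.univ}
    with h | h
  · simp only [iInf_of_isEmpty]
    exact continuous_const
  · simp only [← Finset.inf'_univ_eq_ciInf]
    exact Continuous.finset_inf'_apply _ fun σ _ =>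
      continuous_finsetSum _ fun a _ => continuous_pairEntry _ _

/-- Rounding down to a multiple of `1 / (N + 1)`. -/
def roundDown (N : ℕ) (x : ℝ) : ℚ := (⌊(N + 1) * x⌋ : ℚ) / (N + 1)

theorem monotone_roundDown (N : ℕ) : Monotone (roundDown N) := by
  intro x y hxy
  unfold roundDown
  have : ⌊((N : ℝ) + 1) * x⌋ ≤ ⌊((N : ℝ) + 1) * y⌋ := Int.floor_mono (by gcongr)
  have : (⌊((N : ℝ) + 1) * x⌋ : ℚ) ≤ ⌊((N : ℝ) + 1) * y⌋ := by exact_mod_cast this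
  gcongr

theorem tendsto_roundDown (x : ℝ) :
    Filter.Tendsto (fun N => (roundDown N x : ℝ)) Filter.atTop (nhds x) := by
  refine tendsto_of_tendsto_of_tendsto_of_le_of_le (g := fun N : ℕ => x - 1 / ((N : ℝ) + 1))
    (h := fun _ => x) ?_ tendsto_const_nhds (fun N => ?_) (fun N => ?_)
  · simpa using (tendsto_const_nhds (x := x)).sub tendsto_one_div_add_atTop_nhds_zero_nat
  · have hN : (0 : ℝ) < (N : ℝ) + 1 := by positivity
    have := Int.lt_floor_add_one (((N : ℝ) + 1) * x)
    simp only [roundDown]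
    push_cast
    rw [le_div_iff₀ hN, sub_mul, one_div_mul_cancel hN.ne']
    linarith
  · have hN : (0 : ℝ) < (N : ℝ) + 1 := by positivity
    have := Int.floor_le (((N : ℝ) + 1) * x)
    simp only [roundDown]
    push_cast
    rw [div_le_iff₀ hN]
    linarith

/-- A vector with the four-point condition becomes an ultrametric after subtracting weights of the
leaves (the Farris transform with respect to one leaf). -/
theorem FourPoint.exists_ultrametric {n : ℕ} (hn : 0 < n) {X : (Fin 2 ↪o Fin n) → ℝ}
    (hX : FourPoint X) : ∃ (V : Fin n → Fin n → ℝ) (w : Fin n → ℝ), IsUltrametric V ∧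
      ∀ s, X s = V (s 0) (s 1) + w (s 0) + w (s 1) := by
  classical
  let o : Fin n := ⟨0, hn⟩
  let Y := pairEntry X
  have hY : ∀ i k, Y i k = Y k i := pairEntry_comm X
  obtain ⟨C, hC⟩ := (Set.finite_range fun x : Fin n × Fin n =>
    Y x.1 x.2 - Y x.1 o - Y x.2 o).bddAbove
  have hC' : ∀ i k, Y i k - Y i o - Y k o ≤ C := fun i k => hC ⟨(i, k), rfl⟩
  refine ⟨fun i k => if i = o ∨ k = o then C else Y i k - Y i o - Y k o,
    fun i => if i = o then -C else Y i o, ⟨fun i k => ?_, fun i k l hik hil hlk => ?_⟩, fun s => ?_⟩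
  · simp only [or_comm (a := i = o), hY i k]
    split_ifs <;> ring
  · by_cases hi : i = o
    · simp [hi]
    by_cases hk : k = o
    · simp [hk]
    by_cases hl : l = o
    · simp [hi, hk, hl, hC']
    simp only [hi, hk, hl, or_self, if_false]
    have h := hX i k l o hik hil hi (Ne.symm hlk) hk hl
    rcases le_max_iff.1 h with h | h
    · refine le_max_of_le_left ?_
      change Y i k + Y l o ≤ Y i l + Y k o at h
      linarith
    · refine le_max_of_le_right ?_
      change Y i k + Y l o ≤ Y i o + Y k l at h
      rw [hY k l] at h
      linarith
  · have hne : s 0 ≠ s 1 := s.injective.ne (by decide)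
    rw [eq_pairEntry X s]
    change Y _ _ = _
    by_cases h0 : s 0 = o
    · have h1 : s 1 ≠ o := fun h => hne (h0.trans h.symm)
      simp [h0, h1, hY o]
    · by_cases h1 : s 1 = o
      · simp [h0, h1]
      · simp [h0, h1]
        ring

/-- Real four-point vectors are limits of rational ones, since rounding preserves ultrametrics. -/
theorem FourPoint.phi_mem {n : ℕ} (hn : 0 < n) {X : (Fin 2 ↪o Fin n) → ℝ} (hX : FourPoint X) :
    phi 5 n X ∈ tropicalGrassmannian 5 n := by
  obtain ⟨V, w, hV, hXV⟩ := hX.exists_ultrametric hn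
  have hlim : Filter.Tendsto (fun (N : ℕ) (s : Fin 2 ↪o Fin n) =>
      ((2 * roundDown N (V (s 0) (s 1) / 2) + roundDown N (w (s 0)) + roundDown N (w (s 1)) : ℚ) : ℝ))
      Filter.atTop (nhds X) := by
    refine tendsto_pi_nhds.2 fun s => ?_
    push_cast
    rw [hXV s]
    have := (((tendsto_roundDown (V (s 0) (s 1) / 2)).const_mul 2).add
      (tendsto_roundDown (w (s 0)))).add (tendsto_roundDown (w (s 1)))
    rwa [mul_div_cancel₀ _ two_ne_zero] at this
  refine IsClosed.mem_of_tendsto isClosed_closure (((continuous_phi 5 n).tendsto X).comp hlim)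
    (Filter.Eventually.of_forall fun N => ?_)
  exact phi_mem_tropicalGrassmannian_of_rat
    (U := fun i k => roundDown N (V i k / 2))
    (hV.map fun x y h => monotone_roundDown N (div_le_div_of_nonneg_right h zero_le_two))
    fun i => roundDown N (w i)

theorem isClosed_fourPoint (n : ℕ) : IsClosed {X : (Fin 2 ↪o Fin n) → ℝ | FourPoint X} := by
  simp only [FourPoint, Set.ofPred_forall]
  refine isClosed_iInter fun i => isClosed_iInter fun j => isClosed_iInter fun k =>
    isClosed_iInter fun l => isClosed_iInter fun _ => isClosed_iInter fun _ => isClosed_iInter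
    fun _ => isClosed_iInter fun _ => isClosed_iInter fun _ => isClosed_iInter fun _ => ?_
  have h := fun i k : Fin n => continuous_pairEntry i k
  exact isClosed_le ((h i j).add (h k l)) (((h i k).add (h j l)).max ((h i l).add (h j k)))

/-! ### The Plücker relations and `𝒢_{2,n}` -/

/-- The antisymmetric extension of a family indexed by the increasing pairs. -/
def altEntry {n : ℕ} {R : Type*} [Ring R] (x : (Fin 2 ↪o Fin n) → R) (i j : Fin n) : R :=
  if h : i < j then x (increasingPair i j h)
  else if h : j < i then -x (increasingPair j i h)
  else 0

theorem map_altEntry {n : ℕ} {R R' : Type*} [Ring R] [Ring R'] (φ : R →+* R')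
    (x : (Fin 2 ↪o Fin n) → R) (i j : Fin n) :
    φ (altEntry x i j) = altEntry (fun s => φ (x s)) i j := by
  unfold altEntry
  split_ifs <;> simp

/-- The three-term Plücker relations hold on the zeros of `I_{2,n}`. -/
theorem pluecker_relation {n : ℕ} {x : (Fin 2 ↪o Fin n) → puiseuxField}
    (hx : ∀ f ∈ grassmannIdeal 2 n, MvPolynomial.eval x f = 0) (i j k l : Fin n) :
    altEntry x i j * altEntry x k l - altEntry x i k * altEntry x j l +
      altEntry x i l * altEntry x j k = 0 := by
  let P := altEntry fun s : Fin 2 ↪o Fin n => MvPolynomial.X (R := puiseuxField) s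
  have hP : ∀ i j, MvPolynomial.eval x (P i j) = altEntry x i j := fun i j => by
    simp [P, map_altEntry]
  let g : (Fin 2 ↪o Fin n) → MvPolynomial (Fin 2 × Fin n) puiseuxField := fun s =>
    ((Matrix.mvPolynomialX (Fin 2) (Fin n) puiseuxField).submatrix id s).det
  have hg : ∀ i j, MvPolynomial.aeval g (P i j) =
      (MvPolynomial.X (0, i) * MvPolynomial.X (1, j) -
        MvPolynomial.X (0, j) * MvPolynomial.X (1, i) :
        MvPolynomial (Fin 2 × Fin n) puiseuxField) := by
    intro i j
    have h1 := map_altEntry (MvPolynomial.aeval (R := puiseuxField) g).toRingHom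
      (fun s : Fin 2 ↪o Fin n => MvPolynomial.X (R := puiseuxField) s) i j
    refine h1.trans ?_
    unfold altEntry
    rcases lt_trichotomy i j with h | rfl | h
    · rw [dif_pos h]
      simp [g, Matrix.det_fin_two]
      rfl
    · simp
    · rw [dif_neg (not_lt.2 h.le), dif_pos h]
      simp [g, Matrix.det_fin_two]
      rfl
  have hmem : P i j * P k l - P i k * P j l + P i l * P j k ∈ grassmannIdeal 2 n := by
    change MvPolynomial.aeval g _ = 0
    simp only [map_add, map_sub, map_mul, hg]
    ring
  simpa [hP] using hx _ hmem

theorem tropicalGrassmannian_two_subset (n : ℕ) :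
    tropicalGrassmannian 2 n ⊆ {X | FourPoint X} := by
  refine closure_minimal ?_ (isClosed_fourPoint n)
  rintro X ⟨x, hx0, hx, hX⟩
  let p := fun i j => ((altEntry x i j : puiseuxField) : HahnSeries ℚ ℂ)
  have hp : ∀ i j, i ≠ j → p i j ≠ 0 := by
    intro i j hij
    simp only [p, altEntry]
    rcases lt_or_gt_of_ne hij with h | h
    · rw [dif_pos h]
      exact fun h0 => hx0 _ (Subtype.ext h0)
    · rw [dif_neg (not_lt.2 h.le), dif_pos h]
      exact fun h0 => hx0 _ (neg_eq_zero.1 (Subtype.ext h0))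
  have hval : ∀ i j, i ≠ j → pairEntry X i j = ((-(p i j).order : ℚ) : ℝ) := by
    intro i j hij
    simp only [p, altEntry, pairEntry]
    rcases lt_or_gt_of_ne hij with h | h
    · rw [dif_pos h, dif_pos h, hX]
      rfl
    · rw [dif_neg (not_lt.2 h.le), dif_pos h, dif_neg (not_lt.2 h.le), dif_pos h, hX]
      simp [puiseuxVal]
  intro i j k l hij hik hil hjk hjl hkl
  have hrel := congrArg Subtype.val (pluecker_relation hx i j k l)
  have hrel' : p i j * p k l = p i k * p j l + -(p i l * p j k) := by
    change p i j * p k l - p i k * p j l + p i l * p j k = 0 at hrel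
    rw [← sub_eq_zero, ← hrel]
    ring
  have hne := mul_ne_zero (hp i j hij) (hp k l hkl)
  rw [hrel'] at hne
  have h1 := HahnSeries.min_order_le_order_add hne
  rw [← hrel', HahnSeries.order_neg, HahnSeries.order_mul (hp _ _ hij) (hp _ _ hkl),
    HahnSeries.order_mul (hp _ _ hik) (hp _ _ hjl),
    HahnSeries.order_mul (hp _ _ hil) (hp _ _ hjk)] at h1
  rw [hval _ _ hij, hval _ _ hkl, hval _ _ hik, hval _ _ hjl, hval _ _ hil, hval _ _ hjk]
  have h2 : -(p i j).order + -(p k l).order ≤ max (-(p i k).order + -(p j l).order)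
      (-(p i l).order + -(p j k).order) := by
    rcases min_le_iff.1 h1 with h | h
    · exact le_max_of_le_left (by linarith)
    · exact le_max_of_le_right (by linarith)
  exact_mod_cast h2

/-! ### Paths in trees -/

namespace WeightedTree

variable {V R : Type*} {n : ℕ} (T : WeightedTree V R n)

theorem path_isPath (u v : V) : (T.path u v).IsPath :=
  (T.isTree.existsUnique_path u v).choose_spec.1

variable {T}

theorem path_eq {u v : V} {p : T.graph.Walk u v} (hp : p.IsPath) : T.path u v = p :=
  ((T.isTree.existsUnique_path u v).choose_spec.2 p hp).symm

theorem path_eq_append {u v w : V} (hw : w ∈ (T.path u v).support) :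
    T.path u v = (T.path u w).append (T.path w v) := by
  obtain ⟨q, s, hq, hs, h⟩ := (T.path_isPath u v).mem_support_iff_exists_append.1 hw
  rw [h, path_eq hq, path_eq hs]

theorem path_self (u : V) : T.path u u = .nil := path_eq .nil

theorem path_reverse (u v : V) : (T.path u v).reverse = T.path v u :=
  (path_eq (T.path_isPath u v).reverse).symm

section dist

variable [AddCommMonoid R]

theorem dist_self (u : V) : T.dist u u = 0 := by simp [dist, path_self]

theorem dist_eq_add {u v w : V} (hw : w ∈ (T.path u v).support) :
    T.dist u v = T.dist u w + T.dist w v := by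
  simp [dist, path_eq_append hw]

theorem dist_comm (u v : V) : T.dist u v = T.dist v u := by
  have h : ∀ d : T.graph.Dart, T.edge d.symm = T.edge d := fun d => Subtype.ext (by simp [edge])
  rw [dist, dist, ← path_reverse u v, SimpleGraph.Walk.darts_reverse, List.map_reverse,
    List.sum_reverse, List.map_map]
  congr 1
  exact List.map_congr_left fun d _ => by simp [h]

end dist

/-- The vertex `u` lies on the path from the root `r` to `v`. -/
def Anc (T : WeightedTree V R n) (r u v : V) : Prop := u ∈ (T.path r v).support

namespace Anc

variable {r u v w : V}

theorem refl (r u : V) : T.Anc r u u := SimpleGraph.Walk.end_mem_support _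

theorem root (r u : V) : T.Anc r r u := SimpleGraph.Walk.start_mem_support _

theorem path_eq_append (h : T.Anc r u v) : T.path r v = (T.path r u).append (T.path u v) :=
  WeightedTree.path_eq_append h

theorem length_eq (h : T.Anc r u v) :
    (T.path r v).length = (T.path r u).length + (T.path u v).length := by
  rw [h.path_eq_append, SimpleGraph.Walk.length_append]

theorem trans (h : T.Anc r u v) (h' : T.Anc r v w) : T.Anc r u w := by
  unfold Anc at *
  rw [WeightedTree.path_eq_append h', SimpleGraph.Walk.mem_support_append_iff]
  exact Or.inl h

theorem eq_of_length_le (h : T.Anc r u v) (hle : (T.path r v).length ≤ (T.path r u).length) :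
    u = v := by
  have := h.length_eq
  exact SimpleGraph.Walk.eq_of_length_eq_zero (p := T.path u v) (by omega)

theorem antisymm (h : T.Anc r u v) (h' : T.Anc r v u) : u = v :=
  h.eq_of_length_le (by have := h'.length_eq; omega)

/-- A vertex on the path from `u` down to `v`. -/
theorem of_mem_path (h : T.Anc r u v) (hw : w ∈ (T.path u v).support) :
    T.Anc r u w ∧ T.Anc r w v := by
  have h1 := h.path_eq_append
  rw [WeightedTree.path_eq_append hw, SimpleGraph.Walk.append_assoc] at h1
  have h2 : ((T.path r u).append (T.path u w)).IsPath :=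
    SimpleGraph.Walk.IsPath.of_append_left (h1 ▸ T.path_isPath r v)
  refine ⟨?_, ?_⟩
  · rw [Anc, path_eq h2, SimpleGraph.Walk.mem_support_append_iff]
    exact Or.inl (SimpleGraph.Walk.end_mem_support _)
  · rw [Anc, h1, SimpleGraph.Walk.mem_support_append_iff]
    exact Or.inr (SimpleGraph.Walk.start_mem_support _)

theorem total (h : T.Anc r u w) (h' : T.Anc r v w) : T.Anc r u v ∨ T.Anc r v u := by
  have h1 : u ∈ (T.path r w).support := h
  rw [h'.path_eq_append, SimpleGraph.Walk.mem_support_append_iff] at h1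
  exact h1.imp id fun h2 => (h'.of_mem_path h2).1

theorem of_adj (r : V) (h : T.graph.Adj u v) : T.Anc r u v ∨ T.Anc r v u := by
  by_contra! hn
  exact hn.2 (T.isTree.isAcyclic.mem_support_of_ne_mem_support_of_adj_of_isPath
    (T.path_isPath r u) (T.path_isPath r v) h hn.1)

theorem path_eq_concat (h : T.graph.Adj u v) (h' : T.Anc r u v) :
    T.path r v = (T.path r u).concat h :=
  T.isTree.isAcyclic.path_concat (T.path_isPath r u) (T.path_isPath r v) h h'

/-- The vertices above a child are those above its parent and the child itself. -/
theorem iff_of_adj (h : T.graph.Adj u v) (h' : T.Anc r u v) :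
    T.Anc r w v ↔ T.Anc r w u ∨ w = v := by
  unfold Anc
  rw [path_eq_concat h h', SimpleGraph.Walk.support_concat]
  simp

/-- A vertex other than the root has exactly one neighbour above it. -/
theorem parent_unique (hu : T.graph.Adj u w) (hv : T.graph.Adj v w) (h : T.Anc r u w)
    (h' : T.Anc r v w) : u = v := by
  have h1 := ((iff_of_adj hu h).1 h').resolve_right hv.ne
  have h2 := ((iff_of_adj hv h').1 h).resolve_right hu.ne
  exact h2.antisymm h1

end Anc

/-- The lowest common vertex of the paths from the root to `u` and `v`; the path from `u` to `v`
passes through it. -/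
theorem exists_meet (T : WeightedTree V R n) (r u v : V) :
    ∃ w, T.Anc r w u ∧ T.Anc r w v ∧ (∀ z, T.Anc r z u → T.Anc r z v → T.Anc r z w) ∧
      w ∈ (T.path u v).support := by
  classical
  obtain ⟨w, hw, hmax⟩ := Finset.exists_max_image
    ((T.path r u).support.toFinset.filter fun z => T.Anc r z v) (fun z => (T.path r z).length)
    ⟨r, by simpa using Anc.root r v⟩
  simp only [Finset.mem_filter, List.mem_toFinset] at hw hmax
  obtain ⟨hwu, hwv⟩ : T.Anc r w u ∧ T.Anc r w v := hw
  have hlow : ∀ z, T.Anc r z u → T.Anc r z v → T.Anc r z w := by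
    intro z hzu hzv
    rcases hzu.total hwu with h | h
    · exact h
    · rw [h.eq_of_length_le (hmax z ⟨hzu, hzv⟩)]
      exact Anc.refl _ _
  refine ⟨w, hwu, hwv, hlow, ?_⟩
  have hq : ((T.path w u).reverse.append (T.path w v)).IsPath := by
    refine SimpleGraph.Walk.IsPath.mk' ?_
    rw [SimpleGraph.Walk.support_append, List.nodup_append']
    refine ⟨(T.path_isPath w u).reverse.support_nodup, (T.path_isPath w v).support_nodup.tail, ?_⟩
    intro x hx hx'
    have h1 := (T.path_isPath w v).support_nodup
    rw [← SimpleGraph.Walk.cons_tail_support, List.nodup_cons] at h1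
    have hxu : x ∈ (T.path w u).support := by simpa using hx
    have hxv : x ∈ (T.path w v).support := List.mem_of_mem_tail hx'
    have h2 := hwu.of_mem_path hxu
    have h3 := hwv.of_mem_path hxv
    have h4 := (hlow x h2.2 h3.2).antisymm h2.1
    exact h1.1 (h4 ▸ hx')
  rw [path_eq hq, SimpleGraph.Walk.mem_support_append_iff]
  exact Or.inr (SimpleGraph.Walk.start_mem_support _)

/-- A path passes through leaves only at its ends. -/
theorem eq_or_eq_of_leaf_mem_path {u v : V} {m : Fin n} (h : T.leaf m ∈ (T.path u v).support) :
    T.leaf m = u ∨ T.leaf m = v := by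
  by_contra! hne
  have h1 : (T.graph.neighborSet (T.leaf m)).ncard = 1 := by
    have : T.leaf m ∈ {v | (T.graph.neighborSet v).ncard = 1} := T.range_leaf ▸ ⟨m, rfl⟩
    exact this
  obtain ⟨x, hx⟩ := Set.ncard_eq_one.1 h1
  have hp : ¬(T.path u (T.leaf m)).Nil := SimpleGraph.Walk.not_nil_of_ne hne.1.symm
  have hq : ¬(T.path (T.leaf m) v).Nil := SimpleGraph.Walk.not_nil_of_ne hne.2
  have hpen : (T.path u (T.leaf m)).penultimate = x := by
    have : (T.path u (T.leaf m)).penultimate ∈ T.graph.neighborSet (T.leaf m) :=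
      ((T.path u (T.leaf m)).adj_penultimate hp).symm
    simpa [hx] using this
  have hsnd : (T.path (T.leaf m) v).snd = x := by
    have : (T.path (T.leaf m) v).snd ∈ T.graph.neighborSet (T.leaf m) :=
      (T.path (T.leaf m) v).adj_snd hq
    simpa [hx] using this
  have hdisj := SimpleGraph.Walk.IsPath.disjoint_support_of_append
    (path_eq_append h ▸ T.path_isPath u v) hq
  exact hdisj (a := x) (hpen ▸ SimpleGraph.Walk.getVert_mem_support _ _)
    (hsnd ▸ SimpleGraph.Walk.start_mem_support _)

/-- The meet of two leaves, other than the root, is not a leaf. -/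
theorem not_leaf_of_anc {r : V} {i k m : Fin n} (hik : i ≠ k) (hm : T.leaf m ≠ r)
    (hi : T.Anc r (T.leaf m) (T.leaf i)) (hk : T.Anc r (T.leaf m) (T.leaf k)) : False := by
  have h1 := (eq_or_eq_of_leaf_mem_path hi).resolve_left hm
  have h2 := (eq_or_eq_of_leaf_mem_path hk).resolve_left hm
  exact hik (T.leaf_injective (h1.symm.trans h2))

end WeightedTree

/-! ### Dissimilarity vectors of trees satisfy the four-point condition -/

namespace WeightedTree

variable {V : Type*} {n : ℕ}

theorem pairEntry_dissimilarityVector (T : WeightedTree V ℝ n) {i k : Fin n} (h : i ≠ k) :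
    pairEntry T.dissimilarityVector i k = T.dist (T.leaf i) (T.leaf k) :=
  pairEntry_of_symm (Y := fun i k => T.dist (T.leaf i) (T.leaf k)) (fun _ _ => dist_comm _ _)
    (fun _ => rfl) h

theorem dist_nonneg_of_internal {T : WeightedTree V ℝ n}
    (hT : ∀ e : T.Edge, (∀ i, T.leaf i ∉ (e : Sym2 V)) → 0 ≤ T.length e) {u v : V}
    (huv : ∀ m, T.leaf m ∉ (T.path u v).support) : 0 ≤ T.dist u v := by
  refine List.sum_nonneg fun x hx => ?_
  obtain ⟨d, hd, rfl⟩ := List.mem_map.1 hx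
  refine hT _ fun m hm => huv m ?_
  change T.leaf m ∈ d.edge at hm
  rcases Sym2.mem_iff.1 hm with h | h
  · rw [h]; exact SimpleGraph.Walk.dart_fst_mem_support_of_mem_darts _ hd
  · rw [h]; exact SimpleGraph.Walk.dart_snd_mem_support_of_mem_darts _ hd

/-- Root the tree at the leaf `l`.  The distance of two leaves is the sum of their distances from
`l` minus twice the distance from `l` to their meet, and among the meets of `i, j`, of `i, k` and of
`j, k` the first is below one of the others. -/
theorem fourPoint_dissimilarityVector {T : WeightedTree V ℝ n}
    (hT : ∀ e : T.Edge, (∀ i, T.leaf i ∉ (e : Sym2 V)) → 0 ≤ T.length e) :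
    FourPoint T.dissimilarityVector := by
  intro i j k l hij hik hil hjk hjl hkl
  simp only [pairEntry_dissimilarityVector T hij, pairEntry_dissimilarityVector T hkl,
    pairEntry_dissimilarityVector T hik, pairEntry_dissimilarityVector T hjl,
    pairEntry_dissimilarityVector T hil, pairEntry_dissimilarityVector T hjk]
  set r := T.leaf l with hr
  have hroot : ∀ {a b : Fin n} {w : V}, a ≠ b → a ≠ l → b ≠ l →
      w ∈ (T.path (T.leaf a) (T.leaf b)).support → w ≠ r := by
    rintro a b w hab hal hbl hw rfl
    rcases eq_or_eq_of_leaf_mem_path hw with h | h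
    · exact hal (T.leaf_injective h.symm)
    · exact hbl (T.leaf_injective h.symm)
  have hdist : ∀ {a b : Fin n} {w : V}, T.Anc r w (T.leaf a) → T.Anc r w (T.leaf b) →
      w ∈ (T.path (T.leaf a) (T.leaf b)).support →
      T.dist (T.leaf a) (T.leaf b) = T.dist (T.leaf a) r + T.dist (T.leaf b) r - 2 * T.dist r w := by
    intro a b w ha hb hw
    have h1 := dist_eq_add ha
    have h2 := dist_eq_add hb
    rw [dist_eq_add hw, dist_comm (T.leaf a) r, dist_comm (T.leaf b) r, h1, h2,
      dist_comm (T.leaf a) w]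
    ring
  obtain ⟨w₁, h1i, h1j, h1, h1p⟩ := T.exists_meet r (T.leaf i) (T.leaf j)
  obtain ⟨w₂, h2i, h2k, h2, h2p⟩ := T.exists_meet r (T.leaf i) (T.leaf k)
  obtain ⟨w₃, h3j, h3k, h3, h3p⟩ := T.exists_meet r (T.leaf j) (T.leaf k)
  rw [hdist h1i h1j h1p, hdist h2i h2k h2p, hdist h3j h3k h3p]
  have key : ∀ z, z ≠ r → T.Anc r z (T.leaf i) → T.Anc r z (T.leaf j) →
      T.dist r z ≤ T.dist r w₁ := by
    intro z hz hzi hzj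
    have hzw := h1 z hzi hzj
    rw [dist_eq_add hzw]
    refine le_add_of_nonneg_right (dist_nonneg_of_internal hT fun m hm => ?_)
    obtain ⟨ha, hb⟩ := hzw.of_mem_path hm
    refine not_leaf_of_anc hij ?_ (hb.trans h1i) (hb.trans h1j)
    intro h
    rw [h] at ha
    exact hz (ha.antisymm (Anc.root _ _))
  rcases h2k.total h3k with h | h
  · refine le_max_of_le_left ?_
    have := key w₂ (hroot hik hil hkl h2p) h2i (h.trans h3j)
    linarith
  · refine le_max_of_le_right ?_
    have := key w₃ (hroot hjk hjl hkl h3p) (h.trans h2i) h3j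
    linarith

end WeightedTree

theorem treeSpace_subset (n : ℕ) : treeSpace n ⊆ {X | FourPoint X} := by
  rintro X ⟨V, _, T, hT, rfl⟩
  exact WeightedTree.fourPoint_dissimilarityVector hT

namespace WeightedTree

/-! ### Rooted trees -/

section rooted

variable {V R : Type*} {n : ℕ} {T : WeightedTree V R n} {r : V}

theorem Anc.eq_of_siblings {u b b' x : V} (hb : T.graph.Adj u b) (hb' : T.graph.Adj u b')
    (h : T.Anc r u b) (h' : T.Anc r u b') (hx : T.Anc r b x) (hx' : T.Anc r b' x) : b = b' := by
  rcases hx.total hx' with h1 | h1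
  · exact ((Anc.iff_of_adj hb' h').1 h1).resolve_left fun h2 => hb.ne (h.antisymm h2)
  · exact (((Anc.iff_of_adj hb h).1 h1).resolve_left fun h2 => hb'.ne (h'.antisymm h2)).symm

/-- The next vertex on the way from `u` down to `v`. -/
theorem Anc.exists_child {u v : V} (h : T.Anc r u v) (hne : u ≠ v) :
    ∃ b, T.graph.Adj u b ∧ T.Anc r u b ∧ T.Anc r b v := by
  have hp : ¬(T.path u v).Nil := SimpleGraph.Walk.not_nil_of_ne hne
  have := h.of_mem_path (SimpleGraph.Walk.getVert_mem_support (T.path u v) 1)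
  exact ⟨(T.path u v).snd, (T.path u v).adj_snd hp, this.1, this.2⟩

/-- A neighbour of `u` other than its parent is a child. -/
theorem Anc.of_adj_ne {T : WeightedTree V R n} {x u y : V} (hx : T.graph.Adj x u)
    (h : T.Anc r x u) (hy : T.graph.Adj u y) (hne : y ≠ x) : T.Anc r u y :=
  (Anc.of_adj r hy).resolve_right fun h' => hne (Anc.parent_unique hy.symm hx h' h)

theorem exists_parent {v : V} (hv : v ≠ r) : ∃ u, T.graph.Adj u v ∧ T.Anc r u v := by
  have hp : ¬(T.path r v).Nil := SimpleGraph.Walk.not_nil_of_ne hv.symm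
  exact ⟨(T.path r v).penultimate, (T.path r v).adj_penultimate hp,
    SimpleGraph.Walk.getVert_mem_support _ _⟩

/-- The edges on the path from the root to a vertex are oriented away from the root. -/
theorem anc_of_mem_darts {v : V} {d : T.graph.Dart} (hd : d ∈ (T.path r v).darts) :
    T.Anc r d.fst d.snd := by
  induction hn : (T.path r v).length generalizing v with
  | zero =>
    have := SimpleGraph.Walk.length_darts (T.path r v)
    rw [hn, List.length_eq_zero_iff] at this
    simp [this] at hd
  | succ m ih =>
    have hv : v ≠ r := by
      rintro rfl
      simp [path_self] at hn
    obtain ⟨u, hadj, hu⟩ := exists_parent (T := T) hv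
    rw [Anc.path_eq_concat hadj hu] at hd hn
    rw [SimpleGraph.Walk.length_concat] at hn
    rw [SimpleGraph.Walk.darts_concat, List.concat_eq_append, List.mem_append] at hd
    rcases hd with hd | hd
    · exact ih hd (by omega)
    · rw [List.mem_singleton] at hd
      subst hd
      exact hu

theorem exists_anc_edge (r : V) (e : T.Edge) :
    ∃ a b, ∃ h : T.graph.Adj a b, T.Anc r a b ∧ e = ⟨s(a, b), h⟩ := by
  obtain ⟨e, he⟩ := e
  induction e using Sym2.ind with
  | _ a b =>
    rcases Anc.of_adj r (T := T) he with h | h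
    · exact ⟨a, b, he, h, rfl⟩
    · exact ⟨b, a, SimpleGraph.Adj.symm he, h, Subtype.ext Sym2.eq_swap⟩

open Classical in
/-- The edges on the path from `r` to `v`. -/
def pathEdges (T : WeightedTree V R n) (r v : V) : Finset T.Edge :=
  ((T.path r v).darts.map T.edge).toFinset

theorem map_val_edge {u v : V} (p : T.graph.Walk u v) :
    (p.darts.map T.edge).map Subtype.val = p.edges := by
  rw [List.map_map]
  rfl

theorem mem_pathEdges {a b v : V} (hab : T.graph.Adj a b) (h : T.Anc r a b) :
    (⟨s(a, b), hab⟩ : T.Edge) ∈ T.pathEdges r v ↔ T.Anc r b v := by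
  have key : (⟨s(a, b), hab⟩ : T.Edge) ∈ T.pathEdges r v ↔ s(a, b) ∈ (T.path r v).edges := by
    classical
    rw [pathEdges, List.mem_toFinset, ← map_val_edge]
    exact (List.mem_map_of_injective Subtype.val_injective).symm
  rw [key]
  constructor
  · exact SimpleGraph.Walk.snd_mem_support_of_mem_edges _
  · intro hb
    rw [hb.path_eq_append, Anc.path_eq_concat hab h]
    simp

theorem nodup_map_edge (u v : V) : ((T.path u v).darts.map T.edge).Nodup := by
  refine List.Nodup.of_map Subtype.val ?_
  rw [map_val_edge]
  exact (T.path_isPath u v).isTrail.edges_nodup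

theorem sum_pathEdges {M : Type*} [AddCommMonoid M] (r v : V) (f : T.Edge → M) :
    ∑ e ∈ T.pathEdges r v, f e = ((T.path r v).darts.map fun d => f (T.edge d)).sum := by
  classical
  rw [pathEdges, List.sum_toFinset _ (nodup_map_edge r v), List.map_map]
  rfl

/-- A vertex at the bottom of the tree is a leaf, so below each vertex there is one. -/
theorem exists_leaf_below [Finite V] (hr : r ∉ Set.range T.leaf) (o : Fin n) (v : V) :
    ∃ i, T.Anc r v (T.leaf i) := by
  obtain ⟨z, hz, hmax⟩ := Set.exists_max_image {z | T.Anc r v z}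
    (fun z => (T.path r z).length) (Set.toFinite _) ⟨v, Anc.refl r v⟩
  have hbot : ∀ y, T.Anc r z y → z = y := fun y hy =>
    hy.eq_of_length_le (hmax y (Anc.trans hz hy))
  have hzr : z ≠ r := by
    rintro rfl
    exact hr ⟨o, (hbot _ (Anc.root _ _)).symm⟩
  obtain ⟨x, hadj, hx⟩ := exists_parent (T := T) hzr
  have hN : T.graph.neighborSet z = {x} := by
    ext y
    simp only [SimpleGraph.mem_neighborSet, Set.mem_singleton_iff]
    constructor
    · intro hy
      rcases Anc.of_adj r hy with h | h
      · exact absurd (hbot y h) hy.ne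
      · exact Anc.parent_unique hy.symm hadj h hx
    · rintro rfl
      exact hadj.symm
  have : z ∈ {v | (T.graph.neighborSet v).ncard = 1} := by
    simp [hN]
  rw [← T.range_leaf] at this
  obtain ⟨i, rfl⟩ := this
  exact ⟨i, hz⟩

end rooted

/-! ### The leaf system of an equidistant tree -/

section equidistant

variable {V : Type*} {n : ℕ} {T : WeightedTree V ℚ n} {r : V}

theorem dist_nonneg (hT : ∀ e, 0 < T.length e) (u v : V) : 0 ≤ T.dist u v := by
  refine List.sum_nonneg fun x hx => ?_
  obtain ⟨d, -, rfl⟩ := List.mem_map.1 hx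
  exact (hT _).le

theorem dist_of_adj {u v : V} (h : T.graph.Adj u v) : T.dist u v = T.length ⟨s(u, v), h⟩ := by
  rw [dist, path_eq (SimpleGraph.Walk.IsPath.of_adj h)]
  simp [SimpleGraph.Adj.toWalk, edge]

theorem Anc.dist_le (hT : ∀ e, 0 < T.length e) {u v : V} (h : T.Anc r u v) :
    T.dist r u ≤ T.dist r v := by
  rw [dist_eq_add h]
  exact le_add_of_nonneg_right (dist_nonneg hT _ _)

theorem Anc.dist_lt (hT : ∀ e, 0 < T.length e) {u v : V} (h : T.Anc r u v) (hne : u ≠ v) :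
    T.dist r u < T.dist r v := by
  obtain ⟨b, hadj, hb, hbv⟩ := h.exists_child hne
  refine lt_of_lt_of_le ?_ (hbv.dist_le hT)
  rw [dist_eq_add hb, dist_of_adj hadj]
  exact lt_add_of_pos_right _ (hT _)

/-- The common distance of the leaves from the root. -/
def radius (hT : T.IsEquidistant r) : ℚ := hT.2.2.choose

theorem dist_leaf (hT : T.IsEquidistant r) (i : Fin n) : T.dist r (T.leaf i) = radius hT :=
  hT.2.2.choose_spec i

/-- The height of an edge.  Its top node is the endpoint nearer to the root. -/
def edgeHeight (hT : T.IsEquidistant r) (e : T.Edge) : ℚ :=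
  radius hT - Sym2.lift ⟨fun a b => min (T.dist r a) (T.dist r b), fun _ _ => min_comm _ _⟩ e.1

theorem edgeHeight_eq (hT : T.IsEquidistant r) {a b : V} (hab : T.graph.Adj a b)
    (h : T.Anc r a b) : edgeHeight hT ⟨s(a, b), hab⟩ = radius hT - T.dist r a := by
  change radius hT - min (T.dist r a) (T.dist r b) = _
  rw [min_eq_left (h.dist_le hT.1)]

/-- The lowest common vertex above two leaves. -/
def meet (T : WeightedTree V ℚ n) (r : V) (i k : Fin n) : V :=
  (T.exists_meet r (T.leaf i) (T.leaf k)).choose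

theorem anc_meet_iff {i k : Fin n} {z : V} :
    T.Anc r z (T.meet r i k) ↔ T.Anc r z (T.leaf i) ∧ T.Anc r z (T.leaf k) := by
  have h := (T.exists_meet r (T.leaf i) (T.leaf k)).choose_spec
  exact ⟨fun h' => ⟨h'.trans h.1, h'.trans h.2.1⟩, fun h' => h.2.2.1 z h'.1 h'.2⟩

theorem meet_anc_left (i k : Fin n) : T.Anc r (T.meet r i k) (T.leaf i) :=
  (anc_meet_iff.1 (Anc.refl _ _)).1

theorem meet_comm (i k : Fin n) : T.meet r i k = T.meet r k i :=
  Anc.antisymm (anc_meet_iff.2 (anc_meet_iff.1 (Anc.refl _ _)).symm)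
    (anc_meet_iff.2 (anc_meet_iff.1 (Anc.refl _ _)).symm)

/-- Leaves below different children of `a` meet at `a`. -/
theorem meet_eq {T : WeightedTree V ℚ n} {a b b' : V} {i k : Fin n} (hb : T.graph.Adj a b)
    (hb' : T.graph.Adj a b') (h : T.Anc r a b) (h' : T.Anc r a b') (hne : b ≠ b')
    (hi : T.Anc r b (T.leaf i)) (hk : T.Anc r b' (T.leaf k)) : T.meet r i k = a := by
  by_contra hm
  obtain ⟨c, hc, hac, hcm⟩ := (anc_meet_iff.2 ⟨h.trans hi, h'.trans hk⟩ :
    T.Anc r a (T.meet r i k)).exists_child (Ne.symm hm)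
  have h1 := anc_meet_iff.1 hcm
  exact hne ((Anc.eq_of_siblings hc hb hac h h1.1 hi).symm.trans
    (Anc.eq_of_siblings hc hb' hac h' h1.2 hk))

/-- An equidistant tree as a leaf system: two leaves are separated at the height of their meet. -/
def leafSystem (hT : T.IsEquidistant r) : LeafSystem (Fin n) T.Edge where
  path i := T.pathEdges r (T.leaf i)
  height := edgeHeight hT
  sep i k := radius hT - T.dist r (T.meet r i k)
  height_injOn i := by
    intro e he e' he' h
    obtain ⟨a, b, hab, h1, rfl⟩ := exists_anc_edge r e
    obtain ⟨a', b', hab', h1', rfl⟩ := exists_anc_edge r e'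
    rw [edgeHeight_eq hT hab h1, edgeHeight_eq hT hab' h1', sub_right_inj] at h
    have hb := (mem_pathEdges hab h1).1 he
    have hb' := (mem_pathEdges hab' h1').1 he'
    have haa : a = a' := by
      by_contra hne
      rcases (h1.trans hb).total (h1'.trans hb') with h2 | h2
      · exact (h ▸ h2.dist_lt hT.1 hne).false
      · exact (h ▸ h2.dist_lt hT.1 (Ne.symm hne)).false
    subst haa
    have := Anc.eq_of_siblings hab hab' h1 h1' hb hb'
    subst this
    rfl
  sep_comm i k := by rw [meet_comm]
  mem_iff := by
    intro i k _ e he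
    obtain ⟨a, b, hab, h1, rfl⟩ := exists_anc_edge r e
    rw [mem_pathEdges hab h1] at he ⊢
    rw [edgeHeight_eq hT hab h1, sub_lt_sub_iff_left]
    constructor
    · intro hk
      exact (h1.dist_lt hT.1 hab.ne).trans_le ((anc_meet_iff.2 ⟨he, hk⟩).dist_le hT.1)
    · intro hlt
      refine (anc_meet_iff.1 (?_ : T.Anc r b (T.meet r i k))).2
      rcases he.total (meet_anc_left i k) with h2 | h2
      · exact h2
      · rcases (Anc.iff_of_adj hab h1).1 h2 with h3 | h3
        · exact absurd (h3.dist_le hT.1) (not_le.2 hlt)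
        · exact h3 ▸ Anc.refl _ _
  exists_height_eq := by
    intro i k hik
    have hne : T.meet r i k ≠ T.leaf i := by
      intro h
      have h2 := (anc_meet_iff.1 (Anc.refl r (T.meet r i k))).2
      rw [h] at h2
      exact not_leaf_of_anc hik (fun h' => hT.2.1 ⟨i, h'⟩) (Anc.refl _ _) h2
    obtain ⟨b, hadj, hb, hbi⟩ := (meet_anc_left (r := r) i k).exists_child hne
    exact ⟨_, (mem_pathEdges hadj hb).2 hbi, edgeHeight_eq hT hadj hb⟩

theorem leafSeries_eq {A : Type*} [CommRing A] (hT : T.IsEquidistant r) (a : T.Edge → A)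
    (i : Fin n) : T.leafSeries r a i = (leafSystem hT).series a i := by
  rw [leafSeries, LeafSystem.series]
  refine Eq.trans ?_ (sum_pathEdges r (T.leaf i) fun e =>
    AddMonoidAlgebra.single (edgeHeight hT e) (a e)).symm
  congr 1
  refine List.map_congr_left fun d hd => ?_
  have h1 := anc_of_mem_darts hd
  have h2 : T.Anc r d.fst (T.leaf i) := SimpleGraph.Walk.dart_fst_mem_support_of_mem_darts _ hd
  have h3 : edgeHeight hT (T.edge d) = radius hT - T.dist r d.fst := edgeHeight_eq hT d.adj h1
  rw [h3, ← dist_leaf hT i, dist_eq_add h2, add_sub_cancel_left]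

theorem sum_length_pathEdges (v : V) : ∑ e ∈ T.pathEdges r v, T.length e = T.dist r v :=
  sum_pathEdges r v T.length

theorem sum_length_sdiff (hT : T.IsEquidistant r) (i k : Fin n) [DecidableEq T.Edge] :
    ∑ e ∈ T.pathEdges r (T.leaf i) \ T.pathEdges r (T.leaf k), T.length e =
      (leafSystem hT).sep i k := by
  have h : T.pathEdges r (T.leaf i) ∩ T.pathEdges r (T.leaf k) =
      T.pathEdges r (T.meet r i k) := by
    ext e
    obtain ⟨a, b, hab, h1, rfl⟩ := exists_anc_edge r e
    rw [Finset.mem_inter, mem_pathEdges hab h1, mem_pathEdges hab h1, mem_pathEdges hab h1,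
      anc_meet_iff]
  have h2 := Finset.sum_inter_add_sum_sdiff (T.pathEdges r (T.leaf i)) (T.pathEdges r (T.leaf k))
    T.length
  rw [h, sum_length_pathEdges, sum_length_pathEdges, dist_leaf hT] at h2
  change _ = radius hT - T.dist r (T.meet r i k)
  linarith

/-- The root has two children, and leaves below different children meet at the root. -/
theorem isTop_radius [Finite V] (hT : T.IsEquidistant r) (o : Fin n) :
    (leafSystem hT).IsTop (radius hT) := by
  refine ⟨fun i k _ => sub_le_self _ (dist_nonneg hT.1 _ _), ?_⟩
  have hro : r ≠ T.leaf o := fun h => hT.2.1 ⟨o, h.symm⟩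
  obtain ⟨b, hb, hrb, -⟩ := (Anc.root r (T.leaf o)).exists_child hro
  obtain ⟨b', hb', hne⟩ : ∃ b', T.graph.Adj r b' ∧ b' ≠ b := by
    by_contra! h
    have hN : T.graph.neighborSet r = {b} := by
      ext y
      exact ⟨fun hy => h y hy, fun hy => by rw [Set.mem_singleton_iff.1 hy]; exact hb⟩
    have : r ∈ {v | (T.graph.neighborSet v).ncard = 1} := by simp [hN]
    rw [← T.range_leaf] at this
    exact hT.2.1 this
  have hrb' : T.Anc r r b' := Anc.root r b'
  obtain ⟨i, hi⟩ := exists_leaf_below hT.2.1 o b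
  obtain ⟨k, hk⟩ := exists_leaf_below hT.2.1 o b'
  have hik : i ≠ k := by
    rintro rfl
    exact hne (Anc.eq_of_siblings hb' hb hrb' hrb hk hi)
  refine ⟨i, k, hik, ?_⟩
  change radius hT - T.dist r (T.meet r i k) = radius hT
  rw [meet_eq hb hb' hrb hrb' hne.symm hi hk, dist_self, sub_zero]

end equidistant

/-! ### Length and generic determinant of an equidistant tree with five leaves -/

section five

variable {V : Type*} {T : WeightedTree V ℚ 5} {r : V}

/-- The path to the leaf `i + 1` branches off the union of the earlier paths at the least separation
from an earlier leaf; adding the lengths of the new parts gives the length of the tree. -/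
theorem totalLength_eq [Finite V] (hT : T.IsEquidistant r) {p : Fin 4 → Fin 5}
    (hp : ∀ i, p i < i.succ) (hmin : ∀ i, ∀ l < i.succ,
      (leafSystem hT).sep i.succ (p i) ≤ (leafSystem hT).sep i.succ l) :
    T.totalLength = radius hT + ∑ i, (leafSystem hT).sep i.succ (p i) := by
  classical
  let S := leafSystem hT
  let P : Fin 5 → Finset T.Edge := fun i => T.pathEdges r (T.leaf i)
  have hsub : ∀ i : Fin 4, ∀ l < i.succ, P i.succ ∩ P l ⊆ P (p i) := by
    intro i l hl e he
    obtain ⟨h1, h2⟩ := Finset.mem_inter.1 he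
    exact (S.mem_iff (hp i).ne' e h1).2
      ((hmin i l hl).trans_lt ((S.mem_iff hl.ne' e h1).1 h2))
  have hnew : ∀ (i : Fin 4) (A : Finset T.Edge), (∀ e, e ∈ A ↔ ∃ l < i.succ, e ∈ P l) →
      ∑ e ∈ A ∪ P i.succ, T.length e = ∑ e ∈ A, T.length e + S.sep i.succ (p i) := by
    intro i A hA
    have h1 : P i.succ \ A = P i.succ \ P (p i) := by
      ext e
      simp only [Finset.mem_sdiff, hA, and_congr_right_iff]
      intro he
      refine not_congr ⟨?_, fun h => ⟨p i, hp i, h⟩⟩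
      rintro ⟨l, hl, hel⟩
      exact hsub i l hl (Finset.mem_inter.2 ⟨he, hel⟩)
    rw [← Finset.union_sdiff_self_eq_union, Finset.sum_union Finset.disjoint_sdiff, h1]
    congr 1
    exact sum_length_sdiff hT _ _
  have hcover : ∀ e, e ∈ P 0 ∪ P 1 ∪ P 2 ∪ P 3 ∪ P 4 := by
    intro e
    obtain ⟨a, b, hab, h1, rfl⟩ := exists_anc_edge r e
    obtain ⟨i, hi⟩ := exists_leaf_below hT.2.1 0 b
    have := (mem_pathEdges hab h1).2 hi
    fin_cases i <;> simp only [Finset.mem_union] <;> tauto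
  have hsum : T.totalLength = ∑ e ∈ P 0 ∪ P 1 ∪ P 2 ∪ P 3 ∪ P 4, T.length e :=
    finsum_eq_sum_of_support_subset _ fun e _ => hcover e
  have h0 : ∑ e ∈ P 0, T.length e = radius hT :=
    (sum_length_pathEdges _).trans (dist_leaf hT 0)
  have h1 := hnew 0 (P 0) (by simp)
  have h2 := hnew 1 (P 0 ∪ P 1) (by simp [Fin.exists_fin_succ])
  have h3 := hnew 2 (P 0 ∪ P 1 ∪ P 2) (by simp [Fin.exists_fin_succ])
  have h4 := hnew 3 (P 0 ∪ P 1 ∪ P 2 ∪ P 3) (by simp [Fin.exists_fin_succ])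
  change ∑ e ∈ P 0 ∪ P 1, _ = _ at h1
  change ∑ e ∈ P 0 ∪ P 1 ∪ P 2, _ = _ at h2
  change ∑ e ∈ P 0 ∪ P 1 ∪ P 2 ∪ P 3, _ = _ at h3
  change ∑ e ∈ P 0 ∪ P 1 ∪ P 2 ∪ P 3 ∪ P 4, _ = _ at h4
  rw [hsum, h4, h3, h2, h1, h0, Fin.sum_univ_four]
  simp only [S]
  ring

theorem matrixM_eq {A : Type*} [CommRing A] (hT : T.IsEquidistant r) (a : Fin 3 → T.Edge → A) :
    T.matrixM r a = quadMatrix fun j => (leafSystem hT).series (a j) := by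
  ext k i
  fin_cases k <;> simp [matrixM, quadMatrix, leafSeries_eq hT]

theorem genericDet_eq (hT : T.IsEquidistant r) : T.genericDet r = (leafSystem hT).det := by
  rw [genericDet, matrixM_eq hT, LeafSystem.det]

theorem leadsAt_genericDet [Finite V] (hT : T.IsEquidistant r) :
    LeadsAt (T.genericDet r) T.totalLength (T.leadingPolynomial r) ∧
      T.leadingPolynomial r ≠ 0 ∧ (T.leadingPolynomial r).IsHomogeneous 5 := by
  choose p hp hmin _ using (leafSystem hT).exists_first_nearest
  obtain ⟨c, hc, hhom, hlead⟩ := LeafSystem.exists_leadCoeff (isTop_radius hT 0) hp hmin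
  rw [← totalLength_eq hT hp hmin, ← genericDet_eq] at hlead
  have h : T.leadingPolynomial r = c := hlead.1
  rw [h]
  exact ⟨hlead, hc, hhom⟩

theorem leadsAt_det_matrixM [Finite V] (hT : T.IsEquidistant r) (a : Fin 3 → T.Edge → ℂ) :
    LeadsAt (T.matrixM r a).det T.totalLength
      (MvPolynomial.eval (fun p => a p.1 p.2) (T.leadingPolynomial r)) := by
  have h := (leadsAt_genericDet hT).1.map (MvPolynomial.eval fun p => a p.1 p.2)
  rwa [genericDet_eq hT, LeafSystem.mapRingHom_det, ← matrixM_eq hT] at h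

end five

end WeightedTree

/-! ### Counting the terms of a polynomial -/

/-- A polynomial with integer coefficients as a list of terms; a monomial is a list of variables. -/
abbrev TermList (σ : Type*) := List (ℤ × List σ)

namespace TermList

variable {σ : Type*}

/-- The exponent vector of a monomial. -/
def exponent (l : List σ) : σ →₀ ℕ := (l.map fun x => Finsupp.single x 1).sum

/-- The polynomial of a list of terms. -/
def eval (L : TermList σ) : MvPolynomial σ ℂ :=
  (L.map fun t => MvPolynomial.monomial (exponent t.2) (t.1 : ℂ)).sum

/-- The product of two lists of terms; terms with the same monomial are not merged. -/
def mul (L M : TermList σ) : TermList σ :=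
  L.flatMap fun t => M.map fun u => (t.1 * u.1, t.2 ++ u.2)

/-- The list of terms of the negative. -/
def neg (L : TermList σ) : TermList σ := L.map fun t => (-t.1, t.2)

/-- Add a term to a list, merging it with a term of the same monomial. -/
def insert [DecidableEq σ] (t : ℤ × List σ) : TermList σ → TermList σ
  | [] => [t]
  | u :: L => if t.2.Perm u.2 then (t.1 + u.1, u.2) :: L else u :: insert t L

/-- Merge the terms with the same monomial and drop the terms that cancel. -/
def collect [DecidableEq σ] (L : TermList σ) : TermList σ :=
  (L.foldr insert []).filter fun t => t.1 ≠ 0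

theorem eval_cons (t : ℤ × List σ) (L : TermList σ) :
    eval (t :: L) = MvPolynomial.monomial (exponent t.2) (t.1 : ℂ) + eval L := by simp [eval]

theorem eval_append (L M : TermList σ) : eval (L ++ M) = eval L + eval M := by simp [eval]

theorem eval_neg (L : TermList σ) : eval (neg L) = -eval L := by
  induction L with
  | nil => simp [neg, eval]
  | cons t L ih =>
    rw [neg, List.map_cons, ← neg, eval_cons, eval_cons, ih, neg_add, ← map_neg]
    push_cast
    rfl

theorem eval_mul (L M : TermList σ) : eval (mul L M) = eval L * eval M := by
  have h1 : ∀ t : ℤ × List σ, eval (M.map fun u => (t.1 * u.1, t.2 ++ u.2)) =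
      MvPolynomial.monomial (exponent t.2) (t.1 : ℂ) * eval M := by
    intro t
    induction M with
    | nil => simp [eval]
    | cons u M ih =>
      rw [List.map_cons, eval_cons, eval_cons, ih, mul_add, MvPolynomial.monomial_mul]
      simp [exponent]
  induction L with
  | nil => simp [mul, eval]
  | cons t L ih =>
    rw [mul, List.flatMap_cons, ← mul, eval_append, ih, h1, eval_cons, add_mul]

theorem exponent_perm {l l' : List σ} (h : l.Perm l') : exponent l = exponent l' :=
  (h.map _).sum_eq

theorem eval_collect [DecidableEq σ] (L : TermList σ) : eval (collect L) = eval L := by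
  have h1 : ∀ (t : ℤ × List σ) (M : TermList σ), eval (insert t M) =
      MvPolynomial.monomial (exponent t.2) (t.1 : ℂ) + eval M := by
    intro t M
    induction M with
    | nil => simp [insert, eval]
    | cons u M ih =>
      rw [insert]
      split_ifs with h
      · rw [eval_cons, eval_cons, exponent_perm h, ← add_assoc, ← map_add]
        push_cast
        rfl
      · rw [eval_cons, eval_cons, ih, add_left_comm]
  have h2 : ∀ M : TermList σ, eval (M.filter fun t => t.1 ≠ 0) = eval M := by
    intro M
    induction M with
    | nil => rfl
    | cons t M ih =>
      rw [List.filter_cons]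
      split_ifs with h
      · rw [eval_cons, eval_cons, ih]
      · have : t.1 = 0 := by simpa using h
        rw [eval_cons, ih, this]
        simp
  rw [collect, h2]
  induction L with
  | nil => rfl
  | cons t L ih => rw [List.foldr_cons, h1, ih, eval_cons]

theorem support_eval [DecidableEq σ] {L : TermList σ} (h : (L.map fun t => exponent t.2).Nodup)
    (h0 : ∀ t ∈ L, t.1 ≠ 0) : (eval L).support = (L.map fun t => exponent t.2).toFinset := by
  classical
  induction L with
  | nil => simp [eval]
  | cons t L ih =>
    rw [List.map_cons, List.nodup_cons] at h
    have ih := ih h.2 fun u hu => h0 u (List.mem_cons_of_mem _ hu)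
    have ht : ((t.1 : ℤ) : ℂ) ≠ 0 := by exact_mod_cast h0 t (by simp)
    have hnot : exponent t.2 ∉ (eval L).support := by
      rw [ih, List.mem_toFinset]
      exact h.1
    ext m
    rw [List.map_cons, List.toFinset_cons, Finset.mem_insert, ← ih, eval_cons,
      MvPolynomial.mem_support_iff, MvPolynomial.coeff_add, MvPolynomial.coeff_monomial]
    by_cases hm : exponent t.2 = m
    · subst hm
      rw [MvPolynomial.notMem_support_iff.1 hnot]
      simp [ht]
    · simp [hm, Ne.symm hm]

/-- Distinctness of the monomials may be tested on numerical codes. -/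
theorem card_support_eval {L : TermList σ} (B : σ → ℕ)
    (h : (L.map fun t => (t.2.map B).sum).Nodup) (h0 : ∀ t ∈ L, t.1 ≠ 0) :
    (eval L).support.card = L.length := by
  classical
  have hcode : ∀ l : List σ, (l.map B).sum = (exponent l).sum fun x k => k * B x := by
    intro l
    induction l with
    | nil => simp [exponent]
    | cons x l ih =>
      have hx : exponent (x :: l) = Finsupp.single x 1 + exponent l := by simp [exponent]
      rw [List.map_cons, List.sum_cons, ih, hx,
        Finsupp.sum_add_index' (by simp) (by intros; ring)]
      simp
  have h' : (L.map fun t => exponent t.2).Nodup := by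
    refine List.Nodup.of_map (fun m => m.sum fun x k => k * B x) ?_
    rw [List.map_map]
    simp only [hcode] at h
    exact h
  rw [support_eval h' h0, List.toFinset_card_of_nodup h', List.length_map]

end TermList

namespace LeafSystem

/-- Laplace expansion along the first two rows. -/
theorem det_diffMatrix {R : Type*} [CommRing R] (b : Fin 3 → Fin 4 → R) (s : Fin 4 → R) :
    (diffMatrix b s).det =
      b 0 0 * (b 0 1 * (s 1 + -s 0)) * (b 1 2 * b 2 3 + -(b 1 3 * b 2 2)) +
      (b 0 0 * (b 0 2 * (s 2 + -s 0)) * (b 1 3 * b 2 1 + -(b 1 1 * b 2 3)) +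
      (b 0 0 * (b 0 3 * (s 3 + -s 0)) * (b 1 1 * b 2 2 + -(b 1 2 * b 2 1)) +
      (b 0 1 * (b 0 2 * (s 2 + -s 1)) * (b 1 0 * b 2 3 + -(b 1 3 * b 2 0)) +
      (b 0 1 * (b 0 3 * (s 3 + -s 1)) * (b 1 2 * b 2 0 + -(b 1 0 * b 2 2)) +
      b 0 2 * (b 0 3 * (s 3 + -s 2)) * (b 1 0 * b 2 1 + -(b 1 1 * b 2 0)))))) := by
  simp [diffMatrix, Matrix.det_succ_row_zero, Fin.sum_univ_succ, Fin.succAbove]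
  ring

variable {E : Type*} [DecidableEq E]

/-- The terms of `leadCoeff`: in each summand of the Laplace expansion, the factors with variables
`a_1(e)` are collected; the other factors have no variables in common. -/
def leadTerms (e e' : Fin 4 → E) (α : Fin 5 → E) (p : Fin 4 → Fin 5) : TermList (Fin 3 × E) :=
  let b (j : Fin 3) (i : Fin 4) : TermList (Fin 3 × E) := [(1, [(j, e i)]), (-1, [(j, e' i)])]
  let s (i : Fin 4) : TermList (Fin 3 × E) := [(1, [(0, α i.succ)]), (1, [(0, α (p i))])]
  let q (k l m n : Fin 4) : TermList (Fin 3 × E) :=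
    .mul (.collect (.mul (b 0 k) (.mul (b 0 l) (s l ++ .neg (s k)))))
      (.mul (b 1 m) (b 2 n) ++ .neg (.mul (b 1 n) (b 2 m)))
  q 0 1 2 3 ++ (q 0 2 3 1 ++ (q 0 3 1 2 ++ (q 1 2 0 3 ++ (q 1 3 2 0 ++ q 2 3 0 1))))

theorem eval_leadTerms (e e' : Fin 4 → E) (α : Fin 5 → E) (p : Fin 4 → Fin 5) :
    TermList.eval (leadTerms e e' α p) = leadCoeff e e' α p := by
  rw [leadCoeff, det_diffMatrix]
  have hb : ∀ (j : Fin 3) (i : Fin 4), TermList.eval [(1, [(j, e i)]), (-1, [(j, e' i)])] =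
      MvPolynomial.X (j, e i) - MvPolynomial.X (j, e' i) := fun j i => by
    simp [TermList.eval, TermList.exponent, MvPolynomial.X, sub_eq_add_neg]
  have hs : ∀ i : Fin 4, TermList.eval [(1, [((0 : Fin 3), α i.succ)]), (1, [(0, α (p i))])] =
      MvPolynomial.X (0, α i.succ) + MvPolynomial.X (0, α (p i)) := fun i => by
    simp [TermList.eval, TermList.exponent, MvPolynomial.X]
  simp only [leadTerms, TermList.eval_append, TermList.eval_mul, TermList.eval_collect,
    TermList.eval_neg, hb, hs]

/-- A monomial of degree less than `8` in the variables `a_j(e)` is encoded by a number whose digits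
in base `8` are the exponents.  The remaining condition is decided by computation. -/
theorem card_support_leadCoeff {e e' : Fin 4 → Fin 8} {α : Fin 5 → Fin 8} {p : Fin 4 → Fin 5}
    {N : ℕ}
    (h : ((leadTerms e e' α p).map fun t =>
      (t.2.map fun x : Fin 3 × Fin 8 => 8 ^ (8 * (x.1 : ℕ) + x.2)).sum).Nodup ∧
      (∀ t ∈ leadTerms e e' α p, t.1 ≠ 0) ∧ (leadTerms e e' α p).length = N) :
    (leadCoeff e e' α p).support.card = N := by
  rw [← eval_leadTerms, TermList.card_support_eval _ h.1 h.2.1, h.2.2]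

set_option maxRecDepth 100000 in
theorem card_support_threeTwo :
    (leadCoeff ![4, 5, 1, 7] ![3, 2, 0, 6] (![0, 0, 0, 1, 1] : Fin 5 → Fin 8)
      ![0, 0, 0, 3]).support.card = 272 :=
  card_support_leadCoeff (by decide +kernel)

set_option maxRecDepth 100000 in
theorem card_support_caterpillar :
    (leadCoeff ![4, 5, 6, 7] ![3, 2, 1, 0] (![0, 0, 0, 0, 7] : Fin 5 → Fin 8)
      ![0, 0, 0, 0]).support.card = 144 :=
  card_support_leadCoeff (by decide +kernel)

set_option maxRecDepth 100000 in
theorem card_support_balanced :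
    (leadCoeff ![4, 2, 6, 7] ![3, 1, 5, 0] (![0, 0, 0, 0, 7] : Fin 5 → Fin 8)
      ![0, 0, 2, 0]).support.card = 144 :=
  card_support_leadCoeff (by decide +kernel)

end LeafSystem

namespace WeightedTree

/-! ### The number of terms for the three binary types -/

section types

variable {V : Type*} {R : Type*} {n : ℕ} {r : V}

/-- A rooted tree on the vertices `0, …, 8` with root `0` is given by the parents of the other
vertices.  If the leaves are `4, …, 8`, the polynomial `c_T` of a tree of this type is, up to sign and
the names of the variables, the polynomial `leadCoeff` formed from the edges above the vertices
`e i + 1`, `e' i + 1` and `α i + 1`. -/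
theorem card_support_of_hasType [Finite V] {T : WeightedTree V ℚ 5} (hT : T.IsEquidistant r)
    {G : SimpleGraph (Fin 9)} {par : Fin 9 → Fin 9}
    (hG : ∀ a b, G.Adj a b ↔ (b ≠ 0 ∧ a = par b) ∨ (a ≠ 0 ∧ b = par a))
    (hpar0 : par 0 = 0) (hlt : ∀ k, k ≠ 0 → par k < k) (hleaf : ∀ k, 4 ≤ k → ∀ b, par b ≠ k)
    {e e' : Fin 4 → Fin 8} {α : Fin 5 → Fin 8} {p : Fin 4 → Fin 5} (hp : ∀ i, p i < i.succ)
    (hpar : ∀ i, par (e i).succ = par (e' i).succ ∧ e i ≠ e' i)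
    (he : ∀ i, ∃ m : Fin 9, par^[m] (i.succ.natAdd 4) = (e i).succ)
    (he' : ∀ i, ∃ m : Fin 9, par^[m] ((p i).natAdd 4) = (e' i).succ)
    (hα : ∀ i, par (α i).succ = 0 ∧ ∃ m : Fin 9, par^[m] (i.natAdd 4) = (α i).succ)
    {N : ℕ} (hN : (LeafSystem.leadCoeff e e' α p).support.card = N) (hN0 : N ≠ 0)
    (hType : T.HasType r G 0) : (T.leadingPolynomial r).support.card = N := by
  classical
  obtain ⟨f, hf⟩ := hType
  let v : Fin 9 → V := f.symm
  have hv : Function.Injective v := f.symm.injective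
  have hv0 : v 0 = r := by rw [← hf]; exact f.symm_apply_apply r
  have hvadj : ∀ a b, T.graph.Adj (v a) (v b) ↔ G.Adj a b := fun a b => f.symm.map_adj_iff
  have hadj : ∀ k, k ≠ 0 → T.graph.Adj (v (par k)) (v k) := fun k hk =>
    (hvadj _ _).2 ((hG _ _).2 (Or.inl ⟨hk, rfl⟩))
  have hanc : ∀ k, k ≠ 0 → T.Anc r (v (par k)) (v k) := by
    intro k
    induction k using WellFoundedLT.induction with
    | _ k ih =>
      intro hk
      by_cases h0 : par k = 0
      · rw [h0, hv0]; exact Anc.root _ _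
      · refine Anc.of_adj_ne (hadj _ h0) (ih _ (hlt k hk) h0) (hadj k hk) (hv.ne ?_)
        exact ((hlt _ h0).trans (hlt k hk)).ne'
  have hiter : ∀ m k, par^[m] k ≠ 0 → T.Anc r (v (par^[m] k)) (v k) := by
    intro m
    induction m with
    | zero => exact fun k _ => Anc.refl _ _
    | succ m ih =>
      intro k hk
      rw [Function.iterate_succ_apply] at hk ⊢
      by_cases hk0 : k = 0
      · subst hk0
        rw [hpar0, Function.iterate_fixed hpar0] at hk
        exact absurd rfl hk
      · exact (ih _ hk).trans (hanc k hk0)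
  have hleafV : ∀ j : Fin 5, ∃ i, T.leaf i = v (j.natAdd 4) := by
    intro j
    have hj4 : (4 : Fin 9) ≤ j.natAdd 4 := by revert j; decide
    have hj0 : (j.natAdd 4 : Fin 9) ≠ 0 := by revert j; decide
    have hNb : T.graph.neighborSet (v (j.natAdd 4)) = {v (par (j.natAdd 4))} := by
      ext y
      obtain ⟨b, rfl⟩ := f.symm.surjective y
      simp only [SimpleGraph.mem_neighborSet, Set.mem_singleton_iff]
      change T.graph.Adj (v _) (v b) ↔ v b = _
      rw [hvadj, hG, hv.eq_iff]
      constructor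
      · rintro (h | h)
        · exact absurd h.2.symm (hleaf _ hj4 b)
        · exact h.2
      · exact fun h => Or.inr ⟨hj0, h⟩
    have : v (j.natAdd 4) ∈ {v | (T.graph.neighborSet v).ncard = 1} := by simp [hNb]
    rwa [← T.range_leaf] at this
  choose π₀ hπ₀ using hleafV
  have hπinj : Function.Injective π₀ := by
    intro j k hjk
    have := hπ₀ j
    rw [hjk, hπ₀ k] at this
    exact (Fin.natAdd_injective _ _ (hv this)).symm
  let π : Equiv.Perm (Fin 5) := Equiv.ofBijective π₀ (Finite.injective_iff_bijective.1 hπinj)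
  have hπ : ∀ j, T.leaf (π j) = v (j.natAdd 4) := hπ₀
  let κ : Fin 8 → T.Edge := fun k => ⟨s(v (par k.succ), v k.succ), hadj _ (Fin.succ_ne_zero k)⟩
  have hκ : Function.Injective κ := by
    intro k l hkl
    rcases Sym2.eq_iff.1 (congrArg Subtype.val hkl) with h | h
    · exact Fin.succ_injective _ (hv h.2)
    · have h1 := hlt _ (Fin.succ_ne_zero k)
      have h2 := hlt _ (Fin.succ_ne_zero l)
      rw [hv h.1] at h1
      rw [← hv h.2] at h2
      exact absurd h1 (not_lt.2 h2.le)
  let S := (leafSystem hT).comap π.toEmbedding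
  have hmem : ∀ {k : Fin 8} {j : Fin 5}, (∃ m : Fin 9, par^[m] (j.natAdd 4) = k.succ) →
      T.Anc r (v k.succ) (T.leaf (π j)) := by
    rintro k j ⟨m, hm⟩
    rw [hπ, ← hm]
    exact hiter _ _ (hm ▸ Fin.succ_ne_zero k)
  have hpath : ∀ {k : Fin 8} {j : Fin 5}, (∃ m : Fin 9, par^[m] (j.natAdd 4) = k.succ) →
      κ k ∈ S.path j := fun {k j} h =>
    (mem_pathEdges (hadj _ (Fin.succ_ne_zero k)) (hanc _ (Fin.succ_ne_zero k))).2 (hmem h)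
  have hheight : ∀ k : Fin 8, S.height (κ k) = radius hT - T.dist r (v (par k.succ)) := fun k =>
    edgeHeight_eq hT (hadj _ (Fin.succ_ne_zero k)) (hanc _ (Fin.succ_ne_zero k))
  have hsep : ∀ i, S.sep i.succ (p i) = radius hT - T.dist r (v (par (e i).succ)) := by
    intro i
    have hz := Fin.succ_ne_zero (e i)
    have hz' := Fin.succ_ne_zero (e' i)
    have := meet_eq (hadj _ hz) ((hpar i).1 ▸ hadj _ hz') (hanc _ hz) ((hpar i).1 ▸ hanc _ hz')
      (hv.ne ((Fin.succ_injective _).ne (hpar i).2)) (hmem (he i)) (hmem (he' i))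
    change radius hT - T.dist r (T.meet r (π i.succ) (π (p i))) = _
    rw [this]
  have htop := (isTop_radius hT 0).comap_perm π
  have hlead : LeadsAt S.det _ (LeafSystem.leadCoeff (κ ∘ e) (κ ∘ e') (κ ∘ α) p) :=
    LeafSystem.leadsAt_det htop.1 hp
      (fun i => ⟨hpath (he i), (hheight _).trans (hsep i).symm⟩)
      (fun i => ⟨hpath (he' i), (hheight _).trans (by rw [hsep i, (hpar i).1])⟩)
      (fun i => ⟨hpath (hα i).2, (hheight _).trans (by rw [(hα i).1, hv0, dist_self, sub_zero])⟩)
  have hren : LeafSystem.leadCoeff (κ ∘ e) (κ ∘ e') (κ ∘ α) p =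
      MvPolynomial.rename (Prod.map id κ) (LeafSystem.leadCoeff e e' α p) := by
    rw [LeafSystem.leadCoeff, LeafSystem.leadCoeff, ← AlgHom.coe_toRingHom, RingHom.map_det]
    congr 1
    ext k i : 2
    fin_cases k <;> simp [diffMatrix]
  have hcard : (LeafSystem.leadCoeff (κ ∘ e) (κ ∘ e') (κ ∘ α) p).support.card = N := by
    rw [hren, MvPolynomial.support_rename_of_injective
      (Function.injective_id.prodMap hκ),
      Finset.card_image_of_injective _ (Finsupp.mapDomain_injective
      (Function.injective_id.prodMap hκ)), hN]
  have hne : LeafSystem.leadCoeff (κ ∘ e) (κ ∘ e') (κ ∘ α) p ≠ 0 := by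
    intro h
    rw [h] at hcard
    exact hN0 (by simpa using hcard.symm)
  obtain ⟨hgen, hgen0, -⟩ := leadsAt_genericDet hT
  rw [genericDet_eq hT] at hgen
  have hgen' := hgen.units_smul (Equiv.Perm.sign π)
  rw [← LeafSystem.det_comap_perm] at hgen'
  have hne' : Equiv.Perm.sign π • T.leadingPolynomial r ≠ 0 := by
    rcases Int.units_eq_one_or (Equiv.Perm.sign π) with h | h <;> simpa [h] using hgen0
  have hc : Equiv.Perm.sign π • T.leadingPolynomial r =
      LeafSystem.leadCoeff (κ ∘ e) (κ ∘ e') (κ ∘ α) p := hgen'.eq_of_ne_zero hlead hne' hne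
  rw [← hcard, ← hc]
  rcases Int.units_eq_one_or (Equiv.Perm.sign π) with h | h <;> simp [h, MvPolynomial.support_neg]

/-- The parents of the vertices in `typeThreeTwo`, with `0` at the root. -/
def parentThreeTwo : Fin 9 → Fin 9 := ![0, 0, 0, 1, 3, 3, 1, 2, 2]

/-- The parents of the vertices in `typeCaterpillar`, with `0` at the root. -/
def parentCaterpillar : Fin 9 → Fin 9 := ![0, 0, 1, 2, 3, 3, 2, 1, 0]

/-- The parents of the vertices in `typeBalanced`, with `0` at the root. -/
def parentBalanced : Fin 9 → Fin 9 := ![0, 0, 1, 1, 2, 2, 3, 3, 0]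

theorem typeThreeTwo_adj (a b : Fin 9) : typeThreeTwo.Adj a b ↔
    (b ≠ 0 ∧ a = parentThreeTwo b) ∨ (a ≠ 0 ∧ b = parentThreeTwo a) := by
  simp only [typeThreeTwo, SimpleGraph.fromEdgeSet_adj, Set.mem_insert_iff, Set.mem_singleton_iff]
  revert a b
  decide

theorem typeCaterpillar_adj (a b : Fin 9) : typeCaterpillar.Adj a b ↔
    (b ≠ 0 ∧ a = parentCaterpillar b) ∨ (a ≠ 0 ∧ b = parentCaterpillar a) := by
  simp only [typeCaterpillar, SimpleGraph.fromEdgeSet_adj, Set.mem_insert_iff,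
    Set.mem_singleton_iff]
  revert a b
  decide

theorem typeBalanced_adj (a b : Fin 9) : typeBalanced.Adj a b ↔
    (b ≠ 0 ∧ a = parentBalanced b) ∨ (a ≠ 0 ∧ b = parentBalanced a) := by
  simp only [typeBalanced, SimpleGraph.fromEdgeSet_adj, Set.mem_insert_iff, Set.mem_singleton_iff]
  revert a b
  decide

variable [Finite V] {T : WeightedTree V ℚ 5}

theorem card_support_of_hasType_threeTwo (hT : T.IsEquidistant r)
    (h : T.HasType r typeThreeTwo 0) :
    (T.leadingPolynomial r).support.card = 272 :=
  card_support_of_hasType hT typeThreeTwo_adj rfl (by decide) (by decide) (by decide) (by decide)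
    (by decide) (by decide) (by decide) LeafSystem.card_support_threeTwo (by decide) h

theorem card_support_of_hasType_caterpillar (hT : T.IsEquidistant r)
    (h : T.HasType r typeCaterpillar 0) :
    (T.leadingPolynomial r).support.card = 144 :=
  card_support_of_hasType hT typeCaterpillar_adj rfl (by decide) (by decide) (by decide) (by decide)
    (by decide) (by decide) (by decide) LeafSystem.card_support_caterpillar (by decide) h

theorem card_support_of_hasType_balanced (hT : T.IsEquidistant r)
    (h : T.HasType r typeBalanced 0) :
    (T.leadingPolynomial r).support.card = 144 :=
  card_support_of_hasType hT typeBalanced_adj rfl (by decide) (by decide) (by decide) (by decide)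
    (by decide) (by decide) (by decide) LeafSystem.card_support_balanced (by decide) h

end types

end WeightedTree

namespace WeightedTree

/-! ### Binary trees with five leaves -/

section binary

variable {V : Type*} {R : Type*} {n : ℕ} {r u v : V} {T : WeightedTree V R n}

/-- The vertex `v` is a child of `u` in the tree with root `r`. -/
def IsChild (T : WeightedTree V R n) (r u v : V) : Prop := T.graph.Adj u v ∧ T.Anc r u v

theorem adj_iff_isChild : T.graph.Adj u v ↔ T.IsChild r u v ∨ T.IsChild r v u :=
  ⟨fun h => (Anc.of_adj r h).imp (⟨h, ·⟩) (⟨h.symm, ·⟩), fun h => h.elim (·.1) (·.1.symm)⟩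

theorem not_isChild_root : ¬T.IsChild r u r := fun h => h.1.ne (h.2.antisymm (Anc.root _ _))

/-- A family `g` of vertices, indexed by the vertices of a graph that is given by parents, is an
isomorphism if the children of each `g k` are, without repetition, the `g b` with `b` below `k`. -/
theorem hasType_of_isChild {G : SimpleGraph (Fin 9)} {par : Fin 9 → Fin 9}
    (hG : ∀ a b, G.Adj a b ↔ (b ≠ 0 ∧ a = par b) ∨ (a ≠ 0 ∧ b = par a))
    (hlt : ∀ k, k ≠ 0 → par k < k) (g : Fin 9 → V) (hg0 : g 0 = r)
    (hg : ∀ k y, T.IsChild r (g k) y ↔ ∃ b, b ≠ 0 ∧ par b = k ∧ y = g b)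
    (hsib : ∀ a b, a < b → a ≠ 0 → par a = par b → g a ≠ g b) : T.HasType r G 0 := by
  have hpar : ∀ b, b ≠ 0 → T.IsChild r (g (par b)) (g b) := fun b hb =>
    (hg _ _).2 ⟨b, hb, rfl, rfl⟩
  have hsib' : ∀ a b, a ≠ 0 → b ≠ 0 → par a = par b → g a = g b → a = b := by
    intro a b ha hb h h'
    rcases lt_trichotomy a b with h1 | h1 | h1
    · exact absurd h' (hsib a b h1 ha h)
    · exact h1
    · exact absurd h'.symm (hsib b a h1 hb h.symm)
  have hinj : Function.Injective g := by
    intro a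
    induction a using WellFoundedLT.induction with
    | _ a ih =>
      intro b hab
      by_cases ha : a = 0
      · by_contra hne
        have hb : b ≠ 0 := fun h => hne (ha.trans h.symm)
        have h1 := hpar b hb
        rw [← hab, ha, hg0] at h1
        exact not_isChild_root h1
      · by_cases hb : b = 0
        · have h1 := hpar a ha
          rw [hab, hb, hg0] at h1
          exact absurd h1 not_isChild_root
        · have h1 := hpar a ha
          have h2 := hpar b hb
          rw [← hab] at h2
          exact hsib' a b ha hb (ih _ (hlt a ha) (Anc.parent_unique h1.1 h2.1 h1.2 h2.2)) hab
  have hsurj : Function.Surjective g := by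
    intro y
    induction hm : (T.path r y).length using Nat.strong_induction_on generalizing y with
    | _ m ih =>
      by_cases hy : y = r
      · exact ⟨0, hg0.trans hy.symm⟩
      · obtain ⟨x, hx, hxy⟩ := exists_parent (T := T) hy
        have hlen : (T.path r x).length < m := by
          rw [← hm, Anc.path_eq_concat hx hxy, SimpleGraph.Walk.length_concat]
          exact Nat.lt_succ_self _
        obtain ⟨k, rfl⟩ := ih _ hlen x rfl
        obtain ⟨b, -, -, rfl⟩ := (hg k y).1 ⟨hx, hxy⟩
        exact ⟨b, rfl⟩
  have hchild : ∀ a b, T.IsChild r (g a) (g b) ↔ b ≠ 0 ∧ a = par b := by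
    intro a b
    rw [hg]
    constructor
    · rintro ⟨c, hc, rfl, h⟩
      rw [hinj h]
      exact ⟨hc, rfl⟩
    · rintro ⟨hb, rfl⟩
      exact ⟨b, hb, rfl, rfl⟩
  let f : G ≃g T.graph :=
    { toEquiv := Equiv.ofBijective g ⟨hinj, hsurj⟩
      map_rel_iff' := by
        intro a b
        change T.graph.Adj (g a) (g b) ↔ _
        rw [adj_iff_isChild, hchild, hchild, hG] }
  refine ⟨f.symm, ?_⟩
  rw [← hg0]
  exact f.symm_apply_apply 0

open Classical in
/-- The number of leaves below a vertex. -/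
def leafCount (T : WeightedTree V R n) (r v : V) : ℕ :=
  (Finset.univ.filter fun i => T.Anc r v (T.leaf i)).card

theorem leafCount_root : T.leafCount r r = n := by
  simp [leafCount, Anc.root]

theorem leafCount_leaf (hr : r ∉ Set.range T.leaf) (i : Fin n) :
    T.leafCount r (T.leaf i) = 1 := by
  rw [leafCount, Finset.card_eq_one]
  refine ⟨i, ?_⟩
  ext j
  simp only [Finset.mem_filter, Finset.mem_univ, true_and, Finset.mem_singleton]
  constructor
  · intro h
    by_contra hne
    exact not_leaf_of_anc hne (fun h' => hr ⟨i, h'⟩) h (Anc.refl _ _)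
  · rintro rfl
    exact Anc.refl _ _

theorem leafCount_pos [Finite V] (hr : r ∉ Set.range T.leaf) (o : Fin n) (v : V) :
    0 < T.leafCount r v := by
  obtain ⟨i, hi⟩ := exists_leaf_below hr o v
  exact Finset.card_pos.2 ⟨i, by simpa using hi⟩

/-- In a binary tree, the leaves below an inner vertex are distributed among its two children. -/
theorem exists_children_of_notMem [Finite V] (hB : T.IsBinary r) (hv : v ∉ Set.range T.leaf) :
    ∃ b c, b ≠ c ∧ (∀ y, T.IsChild r v y ↔ y = b ∨ y = c) ∧
      T.leafCount r v = T.leafCount r b + T.leafCount r c := by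
  classical
  have h2 : {y | T.IsChild r v y}.ncard = 2 := by
    by_cases hvr : v = r
    · subst hvr
      rw [← hB.1]
      congr 1
      ext y
      exact ⟨fun h => h.1, fun h => ⟨h, Anc.root _ _⟩⟩
    · obtain ⟨x, hx, hxv⟩ := exists_parent (T := T) hvr
      have h3 : {y | T.IsChild r v y} = T.graph.neighborSet v \ {x} := by
        ext y
        constructor
        · rintro ⟨h, h'⟩
          refine ⟨h, ?_⟩
          rintro rfl
          exact h.ne (h'.antisymm hxv)
        · rintro ⟨h, h'⟩
          exact ⟨h, Anc.of_adj_ne hx hxv h h'⟩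
      rw [h3, Set.ncard_sdiff_singleton_of_mem (show x ∈ T.graph.neighborSet v from hx.symm),
        hB.2 v hvr hv]
  obtain ⟨b, c, hbc, h⟩ := Set.ncard_eq_two.1 h2
  have hch : ∀ y, T.IsChild r v y ↔ y = b ∨ y = c := fun y => by
    simpa using Set.ext_iff.1 h y
  obtain ⟨hb, hb'⟩ := (hch b).2 (Or.inl rfl)
  obtain ⟨hc, hc'⟩ := (hch c).2 (Or.inr rfl)
  refine ⟨b, c, hbc, hch, ?_⟩
  rw [leafCount, leafCount, leafCount, ← Finset.card_union_of_disjoint]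
  · congr 1
    ext i
    simp only [Finset.mem_filter, Finset.mem_univ, true_and, Finset.mem_union]
    constructor
    · intro hi
      obtain ⟨y, hy, hvy, hyi⟩ := hi.exists_child fun h' => hv ⟨i, h'.symm⟩
      rcases (hch y).1 ⟨hy, hvy⟩ with rfl | rfl
      · exact Or.inl hyi
      · exact Or.inr hyi
    · rintro (hi | hi)
      · exact hb'.trans hi
      · exact hc'.trans hi
  · rw [Finset.disjoint_filter]
    exact fun i _ hi hi' => hbc (Anc.eq_of_siblings hb hc hb' hc' hi hi')

theorem exists_children [Finite V] (hr : r ∉ Set.range T.leaf) (hB : T.IsBinary r)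
    (h2 : 2 ≤ T.leafCount r v) :
    ∃ b c, b ≠ c ∧ (∀ y, T.IsChild r v y ↔ y = b ∨ y = c) ∧
      T.leafCount r v = T.leafCount r b + T.leafCount r c ∧
      T.leafCount r c ≤ T.leafCount r b ∧ 0 < T.leafCount r c := by
  have hv : v ∉ Set.range T.leaf := by
    rintro ⟨i, rfl⟩
    rw [leafCount_leaf hr] at h2
    omega
  have : NeZero n := ⟨by
    rintro rfl
    have : T.leafCount r v = 0 := by simp [leafCount]
    omega⟩
  obtain ⟨b, c, hbc, h, hsum⟩ := exists_children_of_notMem hB hv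
  rcases le_total (T.leafCount r c) (T.leafCount r b) with hle | hle
  · exact ⟨b, c, hbc, h, hsum, hle, leafCount_pos hr 0 _⟩
  · exact ⟨c, b, hbc.symm, fun y => (h y).trans or_comm, by omega, hle, leafCount_pos hr 0 _⟩

theorem not_isChild_of_leafCount [Finite V] (hr : r ∉ Set.range T.leaf) (hB : T.IsBinary r)
    (h1 : T.leafCount r v = 1) (y : V) : ¬T.IsChild r v y := by
  intro hy
  by_cases hv : v ∈ Set.range T.leaf
  · obtain ⟨i, rfl⟩ := hv
    have : NeZero n := ⟨fun h => (Fin.cast h i).elim0⟩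
    obtain ⟨j, hj⟩ := exists_leaf_below hr 0 y
    have h2 := (eq_or_eq_of_leaf_mem_path (hy.2.trans hj)).resolve_left fun h => hr ⟨i, h⟩
    rw [← h2] at hj
    exact hy.1.ne (hy.2.antisymm hj)
  · obtain ⟨b, c, -, -, hsum⟩ := exists_children_of_notMem hB hv
    have : NeZero n := ⟨by
      rintro rfl
      simp [leafCount] at h1⟩
    have := leafCount_pos hr 0 b
    have := leafCount_pos hr 0 c
    omega

/-- The leaf counts of the children of each vertex leave only three possibilities: the root splits
the leaves into `3 + 2` or `4 + 1`, and in the second case `4` is split into `3 + 1` or `2 + 2`. -/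
theorem hasType_of_isBinary [Finite V] {T : WeightedTree V R 5} (hr : r ∉ Set.range T.leaf)
    (hB : T.IsBinary r) : T.HasType r typeThreeTwo 0 ∨ T.HasType r typeCaterpillar 0 ∨
      T.HasType r typeBalanced 0 := by
  have h5 : T.leafCount r r = 5 := leafCount_root
  have hleaf := fun v => not_isChild_of_leafCount (v := v) hr hB
  obtain ⟨b, c, hbc, hch, hsum, hle, hpos⟩ := exists_children hr hB (v := r) (by omega)
  obtain ⟨b₁, b₂, hb, hchb, hsumb, hleb, hposb⟩ := exists_children hr hB (v := b) (by omega)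
  obtain ⟨x₁, x₂, hx, hchx, hsumx, hlex, hposx⟩ := exists_children hr hB (v := b₁) (by omega)
  by_cases h2 : T.leafCount r c = 2
  · left
    obtain ⟨y₁, y₂, hy, hchy, hsumy, hley, hposy⟩ := exists_children hr hB (v := c) (by omega)
    refine hasType_of_isChild typeThreeTwo_adj (by decide) ![r, b, c, b₁, x₁, x₂, b₂, y₁, y₂] rfl
      ?_ ?_
    · have e1 := hleaf x₁ (by omega)
      have e2 := hleaf x₂ (by omega)
      have e3 := hleaf b₂ (by omega)
      have e4 := hleaf y₁ (by omega)
      have e5 := hleaf y₂ (by omega)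
      intro k y
      fin_cases k <;> simp [parentThreeTwo, Fin.exists_fin_succ, *]
    · intro a b
      fin_cases a <;> fin_cases b <;> simp [parentThreeTwo, *]
  right
  have e1 := hleaf c (by omega)
  have e2 := hleaf x₂ (by omega)
  by_cases h2' : T.leafCount r b₂ = 2
  · right
    obtain ⟨y₁, y₂, hy, hchy, hsumy, hley, hposy⟩ := exists_children hr hB (v := b₂) (by omega)
    refine hasType_of_isChild typeBalanced_adj (by decide) ![r, b, b₁, b₂, x₁, x₂, y₁, y₂, c] rfl
      ?_ ?_
    · have e3 := hleaf x₁ (by omega)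
      have e4 := hleaf y₁ (by omega)
      have e5 := hleaf y₂ (by omega)
      intro k y
      fin_cases k <;> simp [parentBalanced, Fin.exists_fin_succ, *]
    · intro a b
      fin_cases a <;> fin_cases b <;> simp [parentBalanced, *]
  · left
    obtain ⟨y₁, y₂, hy, hchy, hsumy, hley, hposy⟩ := exists_children hr hB (v := x₁) (by omega)
    refine hasType_of_isChild typeCaterpillar_adj (by decide) ![r, b, b₁, x₁, y₁, y₂, x₂, b₂, c]
      rfl ?_ ?_
    · have e3 := hleaf b₂ (by omega)
      have e4 := hleaf y₁ (by omega)
      have e5 := hleaf y₂ (by omega)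
      intro k y
      fin_cases k <;> simp [parentCaterpillar, Fin.exists_fin_succ, *]
    · intro a b
      fin_cases a <;> fin_cases b <;> simp [parentCaterpillar, *]

end binary

end WeightedTree

end

theorem mainTheorem2 :
    (∀ (V : Type*) [Finite V] (T : WeightedTree V ℚ 5) (r : V), T.IsEquidistant r →
      HasTDegree (T.genericDet r) T.totalLength ∧
      T.leadingPolynomial r ≠ 0 ∧
      (T.leadingPolynomial r).IsHomogeneous 5 ∧
      (∀ a : Fin 3 → T.Edge → ℂ,
        MvPolynomial.eval (fun p => a p.1 p.2) (T.leadingPolynomial r) ≠ 0 →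
          HasTDegree (T.matrixM r a).det T.totalLength) ∧
      (T.IsBinary r → T.HasType r typeThreeTwo 0 ∨ T.HasType r typeCaterpillar 0 ∨
        T.HasType r typeBalanced 0) ∧
      (T.HasType r typeThreeTwo 0 → (T.leadingPolynomial r).support.card = 272) ∧
      (T.HasType r typeCaterpillar 0 → (T.leadingPolynomial r).support.card = 144) ∧
      (T.HasType r typeBalanced 0 → (T.leadingPolynomial r).support.card = 144)) ∧
    (∀ n : ℕ, 5 ≤ n →
      phi 5 n '' treeSpace n ⊆ tropicalGrassmannian 5 n ∩ Set.range (phi 5 n)) ∧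
    (∀ n : ℕ, 5 ≤ n →
      phi 5 n '' tropicalGrassmannian 2 n ⊆
        tropicalGrassmannian 5 n ∩ Set.range (phi 5 n)) := by
  refine ⟨fun V _ T r hT => ?_, fun n hn => ?_, fun n hn => ?_⟩
  · obtain ⟨hlead, hne, hhom⟩ := WeightedTree.leadsAt_genericDet hT
    exact ⟨hlead.hasTDegree hne, hne, hhom,
      fun a ha => (WeightedTree.leadsAt_det_matrixM hT a).hasTDegree ha,
      WeightedTree.hasType_of_isBinary hT.2.1, WeightedTree.card_support_of_hasType_threeTwo hT,
      WeightedTree.card_support_of_hasType_caterpillar hT,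
      WeightedTree.card_support_of_hasType_balanced hT⟩
  · rintro _ ⟨X, hX, rfl⟩
    exact ⟨FourPoint.phi_mem (by omega) (treeSpace_subset n hX), X, rfl⟩
  · rintro _ ⟨X, hX, rfl⟩
    exact ⟨FourPoint.phi_mem (by omega) (tropicalGrassmannian_two_subset n hX), X, rfl⟩
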